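/- **Setting.** Graphs are finite and undirected, and loops are allowed. For a graph $\Gamma=(V,E)$ let $\bar V=\{\bar a: a\in V\}$ be a disjoint copy of $V$, and let $\mathbb M_\Gamma$ be the monoid generated by $V\cup\bar V$ with the relations $a\bar a=1$ for $a\in V$, and $xy=yx$ for $x\in\{a,\bar a\}$, $y\in\{b,\bar b\}$ whenever $\{a,b\}\in E$ (with $a=b$ if $a$ is looped). Write $[w]\in\mathbb M_\Gamma$ for the element of a word $w\in(V\cup\bar V)^*$. The graph $\Gamma$ belongs to $\mathsf{PD}(\mathsf{Grp})$ if $V=U\sqcup W$, where the vertices in $U$ (the pushdown letters) are unlooped and isolated and all vertices in $W$ (the group letters) are looped. A game arena $G$ over $\Gamma$ consists of a finite set $Q=Q_\exists\sqcup Q_\forall$ of states, an initial state $q_{init}$, and transitions $p\xrightarrow{w}q$ with $w\in(V\cup\bar V)^*$, at most one for each pair $(p,q)$ and at least one out of each state. A play is an infinite sequence of configurations in $Q\times\mathbb M_\Gamma$ in which each step from $(p,x)$ goes along a transition $p\xrightarrow{w}q$ to $(q,x[w])$; the owner of the current state chooses the transition, depending on the history of states. The existential player wins a play if every $x$ that occurs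 in it is right-invertible in $\mathbb M_\Gamma$. She wins $\mathsf{FV}(G)$ with initial credit $\lambda\in(V\cup\bar V)^*$ if she has a winning strategy from $(q_{init},[\lambda])$, and she wins $\mathsf{UV}(G)$ if she wins $\mathsf{FV}(G)$ with some initial credit. The size of $G$ is the number of vertices, ordered pairs of adjacent vertices, and states, plus the sum of $1+|w|$ over all transitions $p\xrightarrow{w}q$. **The automata.** For $m\ge 0$ and $1\le i\le m$ let $D_i$ be the three-state DFA over $\{\gamma_1,\dots,\gamma_m\}$ that accepts the words in which any two occurrences of $\gamma_i$ have some $\gamma_j$, $j<i$, between them. Its states are: "no $\gamma_i$ since the start or the last $\gamma_j$ with $j<i$" (initial), "one such $\gamma_i$", and a rejecting sink. **The arena $G^{\mathrm{guess}}$.** Let $G$ be a game arena over a graph in $\mathsf{PD}(\mathsf{Grp})$ with pushdown letters $U$ and group letters $W$, and let $n=|Q|+\sum_{p\xrightarrow{w}q}\max(|w|-1,0)$ (so $n=|Q|$ if all labels have length at most one). The arena $G^{\mathrm{guess}}$ is over the graph in $\mathsf{PD}(\mathsf{Grp})$ with pushdown letters $\{\gamma_0\}\sqcup(U\times\{1,\dots,n\})$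 and the same group letters (with the same edges between them). It has the following transitions, each of which is subdivided by a state of its own, so that there are no parallel transitions. - From the initial state, $\gamma_0$ is pushed and $p_0$ is entered. There are transitions $p_{j-1}\xrightarrow{g}p_j$ for $1\le j\le n$ and $g\in W\cup\bar W\cup\{\varepsilon\}$. From $p_n$ there are transitions to a state $\mathtt{ch}$ that push a letter $(a,i)$, for all $a\in U$ and $1\le i\le n$, and an $\varepsilon$-transition to the copy of $q_{init}$ in the part described last. From $\mathtt{ch}$ there are $\varepsilon$-transitions to $p_0$ and to the initial states of the game versions of $D_1,\dots,D_n$ (where $m=n$). - In the game version of $D_i$, each non-sink state $s$ is a chain $s_0,\dots,s_n$ with transitions $s_{j-1}\xrightarrow{g}s_j$ for $1\le j\le n$ and $g\in W\cup\bar W\cup\{\varepsilon\}$. From $s_n$, for all $a\in U$ and $1\le j\le n$, there is a transition that pops $(a,j)$ and leads to the first state of the chain of $s'$, where $s'$ is the state that $D_i$ reaches from $s$ by reading $\gamma_j$, or, if $s'$ is the sink, to a state with a self-loop that pops $\gamma_0$. Another transition from $s_n$ pops $\gamma_0$ and leads to a state with an $\varepsilon$-self-loop. - The last part is a copy of $G$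 in which a transition $p\xrightarrow{x_1\cdots x_k}q$ becomes a path that processes the letters one at a time. Each push (or pop) of $a\in U$ becomes a choice of the existential player between the pushes (or pops) of the $n$ letters $(a,1),\dots,(a,n)$; group letters are unchanged. The states of the copy of $G$ keep their owners, $\mathtt{ch}$ belongs to the universal player, and all other states belong to the existential player. **Theorem.** 1. For every $m\ge0$, the language $\bigcap_{i=1}^m L(D_i)$ is suffix-closed and contains a word of length $2^m-1$ that is strictly longer than every other word in it. 2. There is a polynomial $P$ such that, for every game arena $G$ over a graph in $\mathsf{PD}(\mathsf{Grp})$, the arena $G^{\mathrm{guess}}$ has size at most $P(\text{size of }G)$, and the existential player wins $\mathsf{UV}(G)$ if and only if she wins $\mathsf{FV}(G^{\mathrm{guess}})$ with the empty initial credit. -/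

import Mathlib

universe u v w

namespace Viability

/-! ## Graphs, graph monoids, valence game arenas -/

/-- Undirected graphs in which loops are allowed. -/
structure LoopGraph (V : Type u) where
  Adj : V → V → Prop
  symm : ∀ a b, Adj a b → Adj b a

/-- `Grp`: every vertex carries a loop. -/
def LoopGraph.IsGrp {V : Type u} (Γ : LoopGraph V) : Prop := ∀ a, Γ.Adj a a

/-- The letters `V ∪ V̄`: the pair `(a, true)` is `a`, the pair `(a, false)` is `ā`. -/
abbrev Letter (V : Type u) : Type u := V × Bool

/-- The defining relations of the graph monoid: `a ā = 1` for every vertex `a`, and `x y = y x`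
for `x ∈ {a, ā}` and `y ∈ {b, b̄}` whenever `a` and `b` are adjacent (`a = b` is allowed, if `a` is
looped). -/
inductive LoopGraph.Rel {V : Type u} (Γ : LoopGraph V) :
    FreeMonoid (Letter V) → FreeMonoid (Letter V) → Prop
  | cancel (a : V) : Γ.Rel (FreeMonoid.of (a, true) * FreeMonoid.of (a, false)) 1
  | comm (a b : V) (s t : Bool) (h : Γ.Adj a b) :
      Γ.Rel (FreeMonoid.of (a, s) * FreeMonoid.of (b, t))
        (FreeMonoid.of (b, t) * FreeMonoid.of (a, s))

/-- The graph monoid `𝕄_Γ`. -/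
abbrev LoopGraph.GraphMonoid {V : Type u} (Γ : LoopGraph V) : Type u := PresentedMonoid Γ.Rel

/-- The element `[x] ∈ 𝕄_Γ` of a word `x ∈ (V ∪ V̄)*`. -/
def LoopGraph.eval {V : Type u} (Γ : LoopGraph V) (x : List (Letter V)) : Γ.GraphMonoid :=
  PresentedMonoid.mk Γ.Rel (FreeMonoid.ofList x)

/-- The right-invertible elements of `𝕄_Γ`. -/
def LoopGraph.RInv {V : Type u} (Γ : LoopGraph V) : Set Γ.GraphMonoid := {x | ∃ y, x * y = 1}

/-- The graph obtained from `Δ` by adding the elements of `U` as isolated vertices without loops.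
The graphs of the class `PD(Grp)` are the graphs `pdGraph U Δ` with `Δ` in `Grp`; the set `U` is
the pushdown alphabet and the vertices of `Δ` are the group alphabet. -/
def pdGraph (U : Type u) {W : Type v} (Δ : LoopGraph W) : LoopGraph (U ⊕ W) where
  Adj
    | .inr a, .inr b => Δ.Adj a b
    | _, _ => False
  symm
    | .inr a, .inr b, h => Δ.symm a b h

inductive Player
  | existential
  | universal
  deriving DecidableEq

/-- A valence game arena over `Γ` with the set `Q` of states. Between any two states `p`, `q`
there is at most one transition: `trans p q = some x` means that it exists and carries the word
`x ∈ (V ∪ V̄)*`, and `trans p q = none` means that there is none. Every state has an outgoing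
transition. -/
structure Arena {V : Type u} (Γ : LoopGraph V) (Q : Type v) where
  owner : Q → Player
  trans : Q → Q → Option (List (Letter V))
  init : Q
  exists_trans : ∀ p, ∃ q, (trans p q).isSome

namespace Arena

variable {V : Type u} {Γ : LoopGraph V} {Q : Type v}

/-- The transitions of the arena, given by their source and target. -/
abbrev Edge (G : Arena Γ Q) : Type v := {e : Q × Q // (G.trans e.1 e.2).isSome}

/-- The label of a transition. -/
abbrev Edge.word {G : Arena Γ Q} (e : G.Edge) : List (Letter V) :=
  (G.trans e.1.1 e.1.2).get e.2

/-- The size of an arena: vertices and edges (ordered adjacent pairs) of the graph, states, transitions with the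
lengths of their labels. -/
noncomputable def size [Fintype V] [Fintype Q] (G : Arena Γ Q) : ℕ :=
  Fintype.card V + Nat.card {a : V × V // Γ.Adj a.1 a.2} + Fintype.card Q
    + ∑ e : G.Edge, (1 + e.word.length)

/-- Configurations. -/
abbrev Conf (_G : Arena Γ Q) : Type (max u v) := Q × Γ.GraphMonoid

/-- A play is an infinite run. -/
def IsPlay (G : Arena Γ Q) (π : ℕ → G.Conf) : Prop :=
  ∀ t, ∃ x, G.trans (π t).1 (π (t + 1)).1 = some x ∧ (π (t + 1)).2 = (π t).2 * Γ.eval x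

/-- A strategy of the player `ι`: for a history `h` of states and a current state `q` owned by
`ι`, the state `next h q` is a successor of `q`. -/
structure Strategy (G : Arena Γ Q) (ι : Player) where
  next : List Q → Q → Q
  legal : ∀ h q, G.owner q = ι → (G.trans q (next h q)).isSome

def Strategy.Compliant {G : Arena Γ Q} {ι : Player} (σ : G.Strategy ι) (π : ℕ → G.Conf) : Prop :=
  ∀ t, G.owner (π t).1 = ι →
    σ.next ((List.range t).map fun s => (π s).1) (π t).1 = (π (t + 1)).1

/-- The existential player wins from `c` for the objective `Obj`. -/
def ExistsWins (G : Arena Γ Q) (Obj : Set (ℕ → G.Conf)) (c : G.Conf) : Prop :=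
  ∃ σ : G.Strategy .existential,
    ∀ π : ℕ → G.Conf, G.IsPlay π → π 0 = c → σ.Compliant π → π ∈ Obj

/-- The right-invertibility objective. -/
def rightInvObj (G : Arena Γ Q) : Set (ℕ → G.Conf) := {π | ∀ t, (π t).2 ∈ Γ.RInv}

/-- The existential player wins the viability game with fixed initial credit `[x]`. -/
def FV (G : Arena Γ Q) (x : List (Letter V)) : Prop := G.ExistsWins G.rightInvObj (G.init, Γ.eval x)

/-- The existential player wins the viability game with unknown initial credit. -/
def UV (G : Arena Γ Q) : Prop := ∃ x, G.FV x

/-- The parameter `n`: the number of states after each transition whose label has length at least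
two is cut into transitions that carry one letter each. If all labels have length at most one,
then it is the number of states. -/
def param [Fintype Q] (G : Arena Γ Q) : ℕ :=
  Fintype.card Q + ∑ e : G.Edge, (e.word.length - 1)

theorem param_pos [Fintype Q] (G : Arena Γ Q) : 0 < G.param :=
  Nat.add_pos_left (Fintype.card_pos_iff.2 ⟨G.init⟩) _

end Arena

/-! ## The automata -/

/-- The automaton `D_i` over the alphabet `γ_0, …, γ_{n-1}`. It accepts the words in which any two
occurrences of `γ_i` have some `γ_j` with `j < i` between them. The state `some b` records whether
`γ_i` was read since the last such `γ_j`, and `none` is the rejecting sink. -/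
def guard {n : ℕ} (i : Fin n) : DFA (Fin n) (Option Bool) where
  step
    | none, _ => none
    | some b, j =>
      if j < i then some false
      else if j = i then (if b then none else some true)
      else some b
  start := some false
  accept := {s | s ≠ none}

/-- The intersection of the languages of all `D_i`. -/
def guardLanguage (n : ℕ) : Language (Fin n) := {x | ∀ i : Fin n, x ∈ (guard i).accepts}

/-! ## The arena in which the existential player guesses the initial credit -/

section Guess

variable {U : Type u} {W : Type v} {Δ : LoopGraph W} {Q : Type w}

/-- The pushdown alphabet of the new arena: a bottom symbol `none`, and `n` indexed copies
`some (a, i)` of each pushdown letter `a`. The group alphabet is unchanged. -/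
abbrev GuessVertex (U : Type u) (W : Type v) (n : ℕ) : Type (max u v) := Option (U × Fin n) ⊕ W

/-- The `i`-th copy of a letter; group letters have only one copy. -/
def copyLetter {n : ℕ} (i : Fin n) : Letter (U ⊕ W) → Letter (GuessVertex U W n)
  | (.inl a, s) => (.inl (some (a, i)), s)
  | (.inr g, s) => (.inr g, s)

/-- The word of an optional group letter (`none` stands for the empty word). -/
def groupWord {n : ℕ} : Option (Letter W) → List (Letter (GuessVertex U W n))
  | none => []
  | some (g, s) => [(.inr g, s)]

/-- The states of the new arena (apart from those that subdivide transitions). -/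
inductive GuessState (G : Arena (pdGraph U Δ) Q) (n : ℕ) : Type w
  /-- the initial state -/
  | start
  /-- the chain `p_0, …, p_n` on which the existential player collects the initial credit -/
  | pick (j : Fin (n + 1))
  /-- the state of the universal player in which he may challenge the guess -/
  | challenge
  /-- the chain of `n + 1` states that replaces the state `some b` of `D_i` -/
  | read (i : Fin n) (b : Bool) (j : Fin (n + 1))
  | happy
  | sad
  /-- the states of the given arena -/
  | game (q : Q)
  /-- the first `k` letters of the transition `e` of the given arena have been processed -/
  | mid (e : G.Edge) (k : Fin (e.word.length + 1))
  deriving DecidableEq, Fintype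

/-- The transitions of the new arena (before they are subdivided). -/
inductive GuessEdge (G : Arena (pdGraph U Δ) Q) (n : ℕ) : Type (max u v w)
  | start
  | pick (j : Fin n) (g : Option (Letter W))
  | push (a : U) (i : Fin n)
  | enter
  | resume
  | challenge (i : Fin n)
  | cancel (i : Fin n) (b : Bool) (j : Fin n) (g : Option (Letter W))
  | pop (i : Fin n) (b : Bool) (a : U) (j : Fin n)
  | bottom (i : Fin n) (b : Bool)
  | happy
  | sad
  | call (e : G.Edge)
  | act (e : G.Edge) (k : Fin e.word.length) (i : Fin n)
  | ret (e : G.Edge)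
  deriving DecidableEq, Fintype

variable {G : Arena (pdGraph U Δ) Q} {n : ℕ}

/-- In the arena, the state `s` of `D_i` is entered at the beginning of its chain. -/
def enterGuard (i : Fin n) : Option Bool → GuessState G n
  | some b => .read i b 0
  | none => .sad

/-- Source, label and target of each transition. The existential player pushes the bottom symbol.
Then, in rounds, she collects a group element of word length at most `n` and pushes one letter, in
a copy `i` of her choice; after each push the universal player may start one of the automata `D_i`.
At the end of some chain she moves to the given arena instead of pushing. In the game version of
`D_i`, she reads the collected stack content by popping it: at most `n` group letters are
multiplied, then one letter is popped, and so on until the bottom symbol is popped. In the given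
arena, each pushdown letter is replaced by its copies; the existential player picks the copy, in
particular when the universal player has chosen to pop. -/
def GuessEdge.data :
    GuessEdge G n → GuessState G n × List (Letter (GuessVertex U W n)) × GuessState G n
  | .start => (.start, [(.inl none, true)], .pick 0)
  | .pick j g => (.pick j.castSucc, groupWord g, .pick j.succ)
  | .push a i => (.pick (Fin.last n), [(.inl (some (a, i)), true)], .challenge)
  | .enter => (.pick (Fin.last n), [], .game G.init)
  | .resume => (.challenge, [], .pick 0)
  | .challenge i => (.challenge, [], enterGuard i (guard i).start)
  | .cancel i b j g => (.read i b j.castSucc, groupWord g, .read i b j.succ)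
  | .pop i b a j =>
      (.read i b (Fin.last n), [(.inl (some (a, j)), false)],
        enterGuard i ((guard i).step (some b) j))
  | .bottom i b => (.read i b (Fin.last n), [(.inl none, false)], .happy)
  | .happy => (.happy, [], .happy)
  | .sad => (.sad, [(.inl none, false)], .sad)
  | .call e => (.game e.1.1, [], .mid e 0)
  | .act e k i => (.mid e k.castSucc, [copyLetter i (e.word.get k)], .mid e k.succ)
  | .ret e => (.mid e (Fin.last _), [], .game e.1.2)

/-- The arena `G^guess`. Each transition of `GuessEdge` is subdivided by a state of its own, since
an arena has at most one transition between two states. -/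
def guess [Fintype Q] [DecidableEq Q] [DecidableEq U] [DecidableEq W]
    (G : Arena (pdGraph U Δ) Q) :
    Arena (pdGraph (Option (U × Fin G.param)) Δ)
      (GuessState G G.param ⊕ GuessEdge G G.param) where
  owner
    | .inl .challenge => .universal
    | .inl (.game q) => G.owner q
    | _ => .existential
  trans
    | .inl s, .inr e => if e.data.1 = s then some e.data.2.1 else none
    | .inr e, .inl s => if e.data.2.2 = s then some [] else none
    | _, _ => none
  init := .inl .start
  exists_trans := by
    have key : ∀ s : GuessState G G.param, ∃ e : GuessEdge G G.param, e.data.1 = s := by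
      intro s
      cases s with
      | start => exact ⟨.start, rfl⟩
      | pick j =>
        cases j using Fin.lastCases with
        | last => exact ⟨.enter, rfl⟩
        | cast j => exact ⟨.pick j none, rfl⟩
      | challenge => exact ⟨.resume, rfl⟩
      | read i b j =>
        cases j using Fin.lastCases with
        | last => exact ⟨.bottom i b, rfl⟩
        | cast j => exact ⟨.cancel i b j none, rfl⟩
      | happy => exact ⟨.happy, rfl⟩
      | sad => exact ⟨.sad, rfl⟩
      | game q =>
        obtain ⟨r, hr⟩ := G.exists_trans q
        exact ⟨.call ⟨(q, r), hr⟩, rfl⟩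
      | mid e k =>
        cases k using Fin.lastCases with
        | last => exact ⟨.ret e, rfl⟩
        | cast k => exact ⟨.act e k ⟨0, G.param_pos⟩, rfl⟩
    rintro (s | e)
    · obtain ⟨e, he⟩ := key s
      exact ⟨.inr e, by simp [he]⟩
    · exact ⟨.inl e.data.2.2, by simp⟩

end Guess

end Viability

open Viability

/-!
The language of the guards has the longest words `z_{m+1} = z_m' 0 z_m'`, where `z_m'` is `z_m` with
its letters shifted by one: the letter `0` occurs at most once, and it resets the guards of all
other letters (`guardLanguage_cases`, `exists_longest_mem_guardLanguage`).

For the arena with guessing, strategies are first replaced by viable sets of configurations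
(`Arena.existsWins_iff_exists_viable`), and right-invertible elements of the graph monoid by stacks
`(g, l)` on which the monoid acts by partial maps (`Stack.exists_val_eq`,
`Stack.exists_act_eq_some`).

The main point is that a winning initial credit can be replaced by a small one
(`LetterGame.exists_small_stack`). Cut the transitions into single letters, so that there are `n`
states. Which states win with a given stack depends on a lower part of the stack only through the
set of states that win with this part (`LetterGame.append_mem_win_iff`). Therefore, if two substacks
have the same set of winning states, then the part between them can be cut out, and the height is
less than `2 ^ n`. For the group elements, let `B d` be the set of states that win with some element
of length at least `d` on top of a fixed lower part. These sets decrease, so `B d = B (d + 1)` for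
some `d ≤ n`. One move changes the length by at most one, hence from `B (d + 1)` one can play on
forever as if the element were always long, in particular nontrivial, without ever popping the
letter below it (`LetterGame.mem_win_bot_of_mem_longWin`). An element of length more than `n` can
thus be replaced by `1`.

A small stack can be guessed: its height is less than `2 ^ n`, so that it can be indexed by a word
that no guard rejects, and the guesser survives all challenges (`Arena.UV.guess_FV`). Conversely,
challenges force the index words to be accepted by all guards, hence to be of bounded length, so
that the copy of the given arena is entered eventually (`Arena.Viable.exists_game_mem`). Deleting
the bottom symbol and the indices is a homomorphism of monoids, and it maps viable configurations of
this copy to viable configurations of the given arena (`Arena.Viable.forget`).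
-/

namespace Viability

/-! ### The guard automata -/

theorem guard_step_none {n : ℕ} (i j : Fin n) : (guard i).step none j = none := rfl

theorem guard_step_some {n : ℕ} (i j : Fin n) (b : Bool) :
    (guard i).step (some b) j =
      if j < i then some false else if j = i then (if b then none else some true) else some b :=
  rfl

theorem guard_evalFrom_none {n : ℕ} (i : Fin n) (x : List (Fin n)) :
    (guard i).evalFrom none x = none := by
  induction x with
  | nil => rfl
  | cons j x ih => rw [DFA.evalFrom_cons, guard_step_none, ih]

theorem mem_guardLanguage {n : ℕ} {x : List (Fin n)} :
    x ∈ guardLanguage n ↔ ∀ i, (guard i).evalFrom (some false) x ≠ none := Iff.rfl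

/-- The initial state of `D_i` accepts more words than any other state. -/
theorem guard_evalFrom_false_ne_none {n : ℕ} (i : Fin n) (x : List (Fin n)) (s : Option Bool)
    (h : (guard i).evalFrom s x ≠ none) : (guard i).evalFrom (some false) x ≠ none := by
  induction x generalizing s with
  | nil => simp
  | cons j x ih =>
    rw [DFA.evalFrom_cons] at h ⊢
    rcases s with _ | b
    · exact absurd (guard_evalFrom_none i x) h
    · by_cases h1 : j < i
      · simpa [guard_step_some, h1] using h
      · by_cases h2 : j = i
        · cases b
          · exact h
          · simp [guard_step_some, h2, guard_evalFrom_none] at h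
        · simp only [guard_step_some, h1, h2, if_false] at h ⊢
          exact ih _ h

theorem mem_guardLanguage_of_append {n : ℕ} {x y : List (Fin n)}
    (h : x ++ y ∈ guardLanguage n) : y ∈ guardLanguage n := by
  rw [mem_guardLanguage] at h ⊢
  intro i
  have := h i
  rw [DFA.evalFrom_of_append] at this
  exact guard_evalFrom_false_ne_none i y _ this

theorem guard_succ_evalFrom_map {n : ℕ} (i : Fin n) (x : List (Fin n)) (s : Option Bool) :
    (guard i.succ).evalFrom s (x.map Fin.succ) = (guard i).evalFrom s x := by
  induction x generalizing s with
  | nil => rfl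
  | cons j x ih =>
    rw [List.map_cons, DFA.evalFrom_cons, DFA.evalFrom_cons, ih]
    congr 1
    rcases s with _ | b
    · rfl
    · simp only [guard_step_some, Fin.succ_lt_succ_iff, Fin.succ_inj]

theorem guard_zero_evalFrom_map {n : ℕ} (x : List (Fin n)) (s : Option Bool) :
    (guard (0 : Fin (n + 1))).evalFrom s (x.map Fin.succ) = s := by
  induction x with
  | nil => rfl
  | cons j x ih =>
    rw [List.map_cons, DFA.evalFrom_cons]
    have : (guard (0 : Fin (n + 1))).step s j.succ = s := by
      rcases s with _ | b
      · rfl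
      · simp [guard_step_some, Fin.succ_ne_zero]
    rw [this, ih]

theorem map_succ_mem_guardLanguage {n : ℕ} {x : List (Fin n)} :
    x.map Fin.succ ∈ guardLanguage (n + 1) ↔ x ∈ guardLanguage n := by
  simp only [mem_guardLanguage, Fin.forall_fin_succ, guard_zero_evalFrom_map,
    guard_succ_evalFrom_map]
  simp

theorem map_succ_append_mem_guardLanguage {n : ℕ} {x y : List (Fin n)} :
    x.map Fin.succ ++ 0 :: y.map Fin.succ ∈ guardLanguage (n + 1) ↔
      x ∈ guardLanguage n ∧ y ∈ guardLanguage n := by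
  simp only [mem_guardLanguage, Fin.forall_fin_succ, DFA.evalFrom_of_append, DFA.evalFrom_cons,
    guard_zero_evalFrom_map, guard_succ_evalFrom_map, ← forall_and]
  have h0 : (guard (0 : Fin (n + 1))).step (some false) 0 = some true := by
    simp [guard_step_some]
  rw [h0]
  simp only [ne_eq, reduceCtorEq, not_false_eq_true, true_and]
  refine forall_congr' fun i => ?_
  rcases h : (guard i).evalFrom (some false) x with _ | b
  · simp [guard_step_none, guard_evalFrom_none]
  · simp [guard_step_some, Fin.succ_pos]

/-- A word either has no letter `0`, or splits at its first one. -/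
theorem exists_map_succ_or_append {n : ℕ} (x : List (Fin (n + 1))) :
    (∃ u : List (Fin n), x = u.map Fin.succ) ∨
      ∃ (u : List (Fin n)) (y : List (Fin (n + 1))), x = u.map Fin.succ ++ 0 :: y := by
  induction x with
  | nil => exact .inl ⟨[], rfl⟩
  | cons j x ih =>
    cases j using Fin.cases with
    | zero => exact .inr ⟨[], x, rfl⟩
    | succ j =>
      rcases ih with ⟨u, rfl⟩ | ⟨u, y, rfl⟩
      · exact .inl ⟨j :: u, rfl⟩
      · exact .inr ⟨j :: u, y, rfl⟩

/-- The letter `0` occurs at most once in a word of the language. -/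
theorem guardLanguage_cases {n : ℕ} {x : List (Fin (n + 1))} (hx : x ∈ guardLanguage (n + 1)) :
    (∃ u ∈ guardLanguage n, x = u.map Fin.succ) ∨
      ∃ u ∈ guardLanguage n, ∃ v ∈ guardLanguage n, x = u.map Fin.succ ++ 0 :: v.map Fin.succ := by
  rcases exists_map_succ_or_append x with ⟨u, rfl⟩ | ⟨u, y, rfl⟩
  · exact .inl ⟨u, map_succ_mem_guardLanguage.1 hx, rfl⟩
  rcases exists_map_succ_or_append y with ⟨v, rfl⟩ | ⟨v, y, rfl⟩
  · obtain ⟨h1, h2⟩ := map_succ_append_mem_guardLanguage.1 hx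
    exact .inr ⟨u, h1, v, h2, rfl⟩
  · refine absurd ?_ (mem_guardLanguage.1 hx 0)
    simp [DFA.evalFrom_of_append, guard_zero_evalFrom_map, DFA.evalFrom_cons, guard_step_some,
      guard_evalFrom_none]

/-- The longest word `z` of the language for `n + 1` letters is `z' 0 z'`, where `z'` is the
longest word for `n` letters, with all letters shifted by one. -/
theorem exists_longest_mem_guardLanguage (n : ℕ) :
    ∃ z ∈ guardLanguage n, z.length = 2 ^ n - 1 ∧
      ∀ x ∈ guardLanguage n, x ≠ z → x.length < z.length := by
  induction n with
  | zero =>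
    refine ⟨[], fun i => i.elim0, rfl, fun x _ hx => ?_⟩
    cases x with
    | nil => exact absurd rfl hx
    | cons i x => exact i.elim0
  | succ n ih =>
    obtain ⟨z, hz, hlen, hmax⟩ := ih
    have hle : ∀ x ∈ guardLanguage n, x.length ≤ z.length := fun x hx => by
      by_cases h : x = z
      · rw [h]
      · exact (hmax x hx h).le
    refine ⟨_, map_succ_append_mem_guardLanguage.2 ⟨hz, hz⟩, ?_, fun x hx hne => ?_⟩
    · have := Nat.one_le_two_pow (n := n)
      simp only [List.length_append, List.length_map, List.length_cons, hlen, pow_succ]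
      omega
    · rcases guardLanguage_cases hx with ⟨u, hu, rfl⟩ | ⟨u, hu, v, hv, rfl⟩
      · have := hle u hu
        simp only [List.length_append, List.length_map, List.length_cons]
        omega
      · have h1 := hle u hu
        have h2 := hle v hv
        simp only [List.length_append, List.length_map, List.length_cons]
        by_cases huz : u = z
        · have hvz : v ≠ z := by
            rintro rfl
            exact hne (by rw [huz])
          have := hmax v hv hvz
          omega
        · have := hmax u hu huz
          omega

theorem length_lt_of_mem_guardLanguage {n : ℕ} {x : List (Fin n)} (hx : x ∈ guardLanguage n) :
    x.length < 2 ^ n := by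
  obtain ⟨z, -, hlen, hmax⟩ := exists_longest_mem_guardLanguage n
  have := Nat.one_le_two_pow (n := n)
  by_cases h : x = z
  · rw [h]
    omega
  · have := hmax x hx h
    omega

theorem exists_mem_guardLanguage_length_eq {n k : ℕ} (hk : k < 2 ^ n) :
    ∃ x ∈ guardLanguage n, x.length = k := by
  obtain ⟨z, hz, hlen, -⟩ := exists_longest_mem_guardLanguage n
  refine ⟨z.drop (z.length - k), ?_, ?_⟩
  · rw [← List.take_append_drop (z.length - k) z] at hz
    exact mem_guardLanguage_of_append hz
  · rw [List.length_drop]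
    omega

/-! ### Viability kernels -/

namespace LoopGraph

variable {V : Type u} {Γ : LoopGraph V}

theorem eval_nil : Γ.eval [] = 1 := rfl

theorem eval_append (x y : List (Letter V)) : Γ.eval (x ++ y) = Γ.eval x * Γ.eval y := rfl

theorem eval_cons (a : Letter V) (x : List (Letter V)) :
    Γ.eval (a :: x) = Γ.eval [a] * Γ.eval x := rfl

theorem exists_eval_eq (m : Γ.GraphMonoid) : ∃ x, Γ.eval x = m := by
  induction m using PresentedMonoid.inductionOn with
  | _ x => exact ⟨FreeMonoid.toList x, rfl⟩

theorem eval_cancel (a : V) : Γ.eval [(a, true)] * Γ.eval [(a, false)] = 1 :=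
  PresentedMonoid.mk_eq_mk_of_rel (.cancel a)

theorem eval_comm {a b : V} (h : Γ.Adj a b) (s t : Bool) :
    Γ.eval [(a, s)] * Γ.eval [(b, t)] = Γ.eval [(b, t)] * Γ.eval [(a, s)] :=
  PresentedMonoid.mk_eq_mk_of_rel (.comm a b s t h)

theorem mem_rInv_of_mul {x y : Γ.GraphMonoid} (h : x * y ∈ Γ.RInv) : x ∈ Γ.RInv := by
  obtain ⟨z, hz⟩ := h
  exact ⟨y * z, by rw [← mul_assoc, hz]⟩

end LoopGraph

namespace Arena

variable {V : Type u} {Γ : LoopGraph V} {Q : Type v}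

/-- A set of configurations is viable if all its elements are right-invertible and the existential
player can keep the play inside it forever. -/
structure Viable (G : Arena Γ Q) (X : Set G.Conf) : Prop where
  rInv : ∀ q x, (q, x) ∈ X → x ∈ Γ.RInv
  existential : ∀ q x, (q, x) ∈ X → G.owner q = .existential →
    ∃ r y, G.trans q r = some y ∧ (r, x * Γ.eval y) ∈ X
  universal : ∀ q x, (q, x) ∈ X → G.owner q = .universal →
    ∀ r y, G.trans q r = some y → (r, x * Γ.eval y) ∈ X

/-- The last state of a path, and the monoid element reached along it from `c`. -/
def track (G : Arena Γ Q) (c : Γ.GraphMonoid) (h : List Q) : Option Q × Γ.GraphMonoid :=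
  h.foldl (fun s q => (some q, match s.1 with
    | none => s.2
    | some p => s.2 * Γ.eval ((G.trans p q).getD []))) (none, c)

theorem track_append_singleton (G : Arena Γ Q) (c : Γ.GraphMonoid) (h : List Q) (q : Q) :
    G.track c (h ++ [q]) = (some q, match (G.track c h).1 with
      | none => (G.track c h).2
      | some p => (G.track c h).2 * Γ.eval ((G.trans p q).getD [])) := by
  simp [track, List.foldl_append]

theorem track_play {G : Arena Γ Q} {π : ℕ → G.Conf} (hπ : G.IsPlay π) (t : ℕ) :
    G.track (π 0).2 ((List.range (t + 1)).map fun s => (π s).1) = (some (π t).1, (π t).2) := by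
  induction t with
  | zero => rfl
  | succ t ih =>
    obtain ⟨x, hx, hx'⟩ := hπ t
    rw [List.range_succ, List.map_append, List.map_singleton, track_append_singleton, ih]
    simp [hx, hx']

open Classical in
/-- The strategy of staying in the set `X` of configurations. It recovers the monoid element of
the current configuration from the history of states. -/
noncomputable def stayStrategy (G : Arena Γ Q) (c : Γ.GraphMonoid) (X : Set G.Conf) :
    G.Strategy .existential where
  next h q :=
    if H : ∃ r y, G.trans q r = some y ∧ (r, (G.track c (h ++ [q])).2 * Γ.eval y) ∈ X then
      H.choose
    else (G.exists_trans q).choose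
  legal h q _ := by
    split_ifs with H
    · obtain ⟨y, hy, -⟩ := H.choose_spec
      simp [hy]
    · exact (G.exists_trans q).choose_spec

theorem stayStrategy_next (G : Arena Γ Q) {c x : Γ.GraphMonoid} {X : Set G.Conf} {h : List Q}
    {q : Q} (hx : (G.track c (h ++ [q])).2 = x)
    (H : ∃ r y, G.trans q r = some y ∧ (r, x * Γ.eval y) ∈ X) :
    ∃ y, G.trans q ((G.stayStrategy c X).next h q) = some y ∧
      ((G.stayStrategy c X).next h q, x * Γ.eval y) ∈ X := by
  subst hx
  simp only [stayStrategy, dif_pos H]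
  exact H.choose_spec

theorem Viable.existsWins {G : Arena Γ Q} {X : Set G.Conf} (hX : G.Viable X) {c : G.Conf}
    (hc : c ∈ X) : G.ExistsWins G.rightInvObj c := by
  refine ⟨G.stayStrategy c.2 X, fun π hπ h0 hσ => ?_⟩
  have key : ∀ t, π t ∈ X := by
    intro t
    induction t with
    | zero => rwa [h0]
    | succ t ih =>
      obtain ⟨x, hx, hx'⟩ := hπ t
      rcases ho : G.owner (π t).1 with _ | _
      · have H := hX.existential _ _ ih ho
        have htrack := track_play hπ t
        rw [List.range_succ, List.map_append, List.map_singleton, h0] at htrack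
        obtain ⟨y, hy, hy'⟩ := G.stayStrategy_next (c := c.2) (X := X)
          (congrArg Prod.snd htrack) H
        rw [hσ t ho] at hy hy'
        rw [hx] at hy
        rw [← Option.some.inj hy, ← hx'] at hy'
        exact hy'
      · have := hX.universal _ _ ih ho _ _ hx
        rwa [← hx'] at this
  exact fun t => hX.rInv _ _ (key t)

/-- The plays that comply with `σ` if `h` is prepended to their history. -/
def CompliantAfter {G : Arena Γ Q} (σ : G.Strategy .existential) (h : List Q)
    (π : ℕ → G.Conf) : Prop :=
  ∀ t, G.owner (π t).1 = .existential →
    σ.next (h ++ (List.range t).map fun s => (π s).1) (π t).1 = (π (t + 1)).1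

theorem exists_compliantAfter {G : Arena Γ Q} (σ : G.Strategy .existential) (h : List Q)
    (c : G.Conf) : ∃ π, G.IsPlay π ∧ π 0 = c ∧ CompliantAfter σ h π := by
  have hstep : ∀ p : List Q × G.Conf, ∃ d : G.Conf,
      (∃ x, G.trans p.2.1 d.1 = some x ∧ d.2 = p.2.2 * Γ.eval x) ∧
      (G.owner p.2.1 = .existential → σ.next p.1 p.2.1 = d.1) := by
    rintro ⟨h, q, x⟩
    by_cases ho : G.owner q = .existential
    · obtain ⟨y, hy⟩ := Option.isSome_iff_exists.1 (σ.legal h q ho)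
      exact ⟨(_, x * Γ.eval y), ⟨y, hy, rfl⟩, fun _ => rfl⟩
    · obtain ⟨r, hr⟩ := G.exists_trans q
      obtain ⟨y, hy⟩ := Option.isSome_iff_exists.1 hr
      exact ⟨(r, x * Γ.eval y), ⟨y, hy, rfl⟩, fun h => absurd h ho⟩
  choose d hd hd' using hstep
  let f : ℕ → List Q × G.Conf := fun t =>
    Nat.rec (h, c) (fun _ p => (p.1 ++ [p.2.1], d p)) t
  have hf : ∀ t, (f t).1 = h ++ (List.range t).map fun s => (f s).2.1 := by
    intro t
    induction t with
    | zero => simp [f]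
    | succ t ih =>
      have : (f (t + 1)).1 = (f t).1 ++ [(f t).2.1] := rfl
      rw [this, ih, List.range_succ, List.map_append, List.append_assoc, List.map_singleton]
  refine ⟨fun t => (f t).2, fun t => hd (f t), rfl, fun t ho => ?_⟩
  have := hd' (f t) ho
  rw [hf] at this
  exact this

/-- The configurations from which, for some history, the given strategy wins form a viable set. -/
theorem ExistsWins.exists_viable {G : Arena Γ Q} {c : G.Conf}
    (hc : G.ExistsWins G.rightInvObj c) : ∃ X, G.Viable X ∧ c ∈ X := by
  obtain ⟨σ, hσ⟩ := hc
  let X : Set G.Conf := {d | ∃ h, ∀ π, G.IsPlay π → π 0 = d → CompliantAfter σ h π →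
    ∀ t, (π t).2 ∈ Γ.RInv}
  have hX : ∀ h (d e : G.Conf), (∀ π, G.IsPlay π → π 0 = d → CompliantAfter σ h π →
      ∀ t, (π t).2 ∈ Γ.RInv) → (∃ x, G.trans d.1 e.1 = some x ∧ e.2 = d.2 * Γ.eval x) →
      (G.owner d.1 = .existential → σ.next h d.1 = e.1) → e ∈ X := by
    intro h d e hd htr hown
    refine ⟨h ++ [d.1], fun π hπ h0 hcomp t => ?_⟩
    refine hd (fun t => Nat.casesOn t d π) ?_ rfl ?_ (t + 1)
    · rintro (_ | t)
      · simpa [h0] using htr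
      · exact hπ t
    · rintro (_ | t) ho
      · simpa [h0] using hown ho
      · have := hcomp t ho
        rw [List.range_succ_eq_map, List.map_cons, List.map_map]
        rw [List.append_assoc] at this
        exact this
  refine ⟨X, ⟨?_, ?_, ?_⟩, ⟨[], fun π hπ h0 hcomp => hσ π hπ h0 fun t ho => ?_⟩⟩
  · rintro q x ⟨h, hd⟩
    obtain ⟨π, hπ, h0, hcomp⟩ := exists_compliantAfter σ h (q, x)
    have := hd π hπ h0 hcomp 0
    rwa [h0] at this
  · rintro q x ⟨h, hd⟩ ho
    obtain ⟨y, hy⟩ := Option.isSome_iff_exists.1 (σ.legal h q ho)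
    exact ⟨_, y, hy, hX h (q, x) _ hd ⟨y, hy, rfl⟩ fun _ => rfl⟩
  · rintro q x ⟨h, hd⟩ ho r y hy
    exact hX h (q, x) _ hd ⟨y, hy, rfl⟩ fun h => by simp [ho] at h
  · simpa using hcomp t ho

theorem existsWins_iff_exists_viable {G : Arena Γ Q} {c : G.Conf} :
    G.ExistsWins G.rightInvObj c ↔ ∃ X, G.Viable X ∧ c ∈ X :=
  ⟨ExistsWins.exists_viable, fun ⟨_, hX, hc⟩ => hX.existsWins hc⟩

end Arena

/-! ### Stacks over a group -/

namespace LoopGraph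

variable {V : Type u} {Γ : LoopGraph V}

/-- The homomorphism on the graph monoid that is given by the images of the letters. -/
def evalHom {M : Type*} [Monoid M] (Γ : LoopGraph V) (f : Letter V → M)
    (hcancel : ∀ a, f (a, true) * f (a, false) = 1)
    (hcomm : ∀ a b s t, Γ.Adj a b → f (a, s) * f (b, t) = f (b, t) * f (a, s)) :
    Γ.GraphMonoid →* M :=
  PresentedMonoid.lift f fun x y h => by
    induction h with
    | cancel a => simpa using hcancel a
    | comm a b s t h => simpa using hcomm a b s t h

/-- Induction over a word, letter by letter from the left. -/
theorem graphMonoid_induction {P : Γ.GraphMonoid → Prop} (one : P 1)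
    (mul : ∀ a x, P x → P (Γ.eval [a] * x)) (x : Γ.GraphMonoid) : P x := by
  obtain ⟨w, rfl⟩ := exists_eval_eq x
  induction w with
  | nil => exact one
  | cons a w ih =>
    rw [eval_cons]
    exact mul a _ ih

/-- If all vertices are looped, then `a` and `ā` are mutually inverse. -/
theorem IsGrp.eval_mul_eval_not (hΓ : Γ.IsGrp) (a : Letter V) :
    Γ.eval [a] * Γ.eval [(a.1, !a.2)] = 1 := by
  rcases a with ⟨a, _ | _⟩
  · exact (eval_comm (hΓ a) _ _).trans (eval_cancel a)
  · exact eval_cancel a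

theorem IsGrp.exists_mul_eval_eq_one (hΓ : Γ.IsGrp) (x : List (Letter V)) :
    ∃ y : List (Letter V), y.length = x.length ∧ Γ.eval x * Γ.eval y = 1 := by
  induction x with
  | nil => exact ⟨[], rfl, rfl⟩
  | cons a x ih =>
    obtain ⟨y, hy, hxy⟩ := ih
    refine ⟨y ++ [(a.1, !a.2)], by simp [hy], ?_⟩
    rw [eval_cons, eval_append, mul_assoc, ← mul_assoc (Γ.eval x), hxy, one_mul,
      hΓ.eval_mul_eval_not]

end LoopGraph

section Stack

variable {U : Type u} {W : Type v} {Δ : LoopGraph W}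

/-- A stack over the pushdown alphabet `U` and the group of `Δ`. The stack `(g, l)` has the group
element `g` on top, and below it are the pushdown letters in `l`, from top to bottom, each together
with the group element below it. -/
abbrev Stack (U : Type u) (Δ : LoopGraph W) : Type (max u v) :=
  Δ.GraphMonoid × List (U × Δ.GraphMonoid)

namespace Stack

open Classical in
/-- The effect of a letter on a stack; a pop fails unless the topmost group element is trivial and
the topmost pushdown letter is the one to be popped. -/
noncomputable def act : Letter (U ⊕ W) → Stack U Δ → Option (Stack U Δ)
  | (.inl a, true), (g, l) => some (1, (a, g) :: l)
  | (.inl _, false), (_, []) => none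
  | (.inl a, false), (g, (b, h) :: l) => if g = 1 ∧ b = a then some (h, l) else none
  | (.inr c, s), (g, l) => some (g * Δ.eval [(c, s)], l)

theorem act_push (a : U) (σ : Stack U Δ) :
    act (.inl a, true) σ = some (1, (a, σ.1) :: σ.2) := rfl

theorem act_group (c : W) (s : Bool) (σ : Stack U Δ) :
    act (.inr c, s) σ = some (σ.1 * Δ.eval [(c, s)], σ.2) := rfl

theorem act_pop_eq_some_iff {a : U} {σ τ : Stack U Δ} :
    act (.inl a, false) σ = some τ ↔ σ = (1, (a, τ.1) :: τ.2) := by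
  rcases σ with ⟨g, _ | ⟨⟨b, h⟩, l⟩⟩
  · simp [act]
  · rcases τ with ⟨k, t⟩
    simp only [act, Option.ite_none_right_eq_some, Option.some.injEq, Prod.mk.injEq,
      List.cons.injEq]
    tauto

/-- The inclusion of the group into the graph monoid. -/
def groupHom (U : Type u) (Δ : LoopGraph W) : Δ.GraphMonoid →* (pdGraph U Δ).GraphMonoid :=
  Δ.evalHom (fun c => (pdGraph U Δ).eval [(.inr c.1, c.2)])
    (fun _ => LoopGraph.eval_cancel _)
    (fun a b s t h => LoopGraph.eval_comm (Γ := pdGraph U Δ) (a := .inr a) (b := .inr b) h s t)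

/-- The monoid element of the part of a stack below its topmost group element. -/
def baseVal : List (U × Δ.GraphMonoid) → (pdGraph U Δ).GraphMonoid
  | [] => 1
  | (a, h) :: l => baseVal l * groupHom U Δ h * (pdGraph U Δ).eval [(.inl a, true)]

/-- The monoid element of a stack. -/
def val (σ : Stack U Δ) : (pdGraph U Δ).GraphMonoid := baseVal σ.2 * groupHom U Δ σ.1

theorem val_nil : val ((1, []) : Stack U Δ) = 1 := by simp [val, baseVal]

theorem val_push (a : U) (σ : Stack U Δ) :
    val (1, (a, σ.1) :: σ.2) = val σ * (pdGraph U Δ).eval [(.inl a, true)] := by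
  simp [val, baseVal]

theorem val_mul_group (g h : Δ.GraphMonoid) (l : List (U × Δ.GraphMonoid)) :
    val (g * h, l) = val (g, l) * groupHom U Δ h := by
  simp [val, mul_assoc]

theorem val_of_act {x : Letter (U ⊕ W)} {σ τ : Stack U Δ} (h : act x σ = some τ) :
    val τ = val σ * (pdGraph U Δ).eval [x] := by
  rcases x with ⟨a | c, _ | _⟩
  · rw [act_pop_eq_some_iff] at h
    subst h
    rw [val_push, mul_assoc, LoopGraph.eval_cancel, mul_one]
  · rw [act_push] at h
    rw [← Option.some.inj h, val_push]
  all_goals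
    rw [act_group] at h
    rw [← Option.some.inj h, val_mul_group]
    rfl

/-- The graph monoid acts on stacks, where `none` stands for a failure. -/
noncomputable def runHom (U : Type u) (Δ : LoopGraph W) :
    (pdGraph U Δ).GraphMonoid →* (Function.End (Option (Stack U Δ)))ᵐᵒᵖ :=
  (pdGraph U Δ).evalHom (fun x => MulOpposite.op fun o => o.bind (act x))
    (by
      rintro (a | c) <;> refine MulOpposite.unop_injective (funext fun o => ?_) <;>
        rcases o with _ | σ
      · rfl
      · exact act_pop_eq_some_iff.2 rfl
      · rfl
      · change some (_, σ.2) = some σ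
        rw [mul_assoc, LoopGraph.eval_cancel, mul_one])
    (by
      rintro (a | a) (b | b) s t h
      · exact h.elim
      · exact h.elim
      · exact h.elim
      · refine MulOpposite.unop_injective (funext fun o => ?_)
        rcases o with _ | σ
        · rfl
        · change some (_, σ.2) = some (_, σ.2)
          rw [mul_assoc, LoopGraph.eval_comm (Γ := Δ) h, ← mul_assoc])

/-- The effect of a monoid element on a stack. -/
noncomputable def run (x : (pdGraph U Δ).GraphMonoid) (o : Option (Stack U Δ)) :
    Option (Stack U Δ) :=
  (runHom U Δ x).unop o

theorem run_one (o : Option (Stack U Δ)) : run 1 o = o := by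
  simp only [run, map_one]
  rfl

theorem run_mul (x y : (pdGraph U Δ).GraphMonoid) (o : Option (Stack U Δ)) :
    run (x * y) o = run y (run x o) := by
  simp only [run, map_mul]
  rfl

theorem run_eval_singleton (a : Letter (U ⊕ W)) (o : Option (Stack U Δ)) :
    run ((pdGraph U Δ).eval [a]) o = o.bind (act a) := rfl

theorem run_none (x : (pdGraph U Δ).GraphMonoid) : run x none = none := by
  induction x using LoopGraph.graphMonoid_induction with
  | one => exact run_one _
  | mul a x ih => rw [run_mul, run_eval_singleton, Option.bind_none, ih]

theorem val_of_run {x : (pdGraph U Δ).GraphMonoid} {σ τ : Stack U Δ}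
    (h : run x (some σ) = some τ) : val τ = val σ * x := by
  induction x using LoopGraph.graphMonoid_induction generalizing σ with
  | one =>
    rw [run_one] at h
    rw [Option.some.inj h, mul_one]
  | mul a x ih =>
    rw [run_mul, run_eval_singleton, Option.bind_some] at h
    rcases hσ : act a σ with _ | σ'
    · rw [hσ, run_none] at h
      simp at h
    · rw [hσ] at h
      rw [ih h, val_of_act hσ, mul_assoc]

theorem run_groupHom (x g : Δ.GraphMonoid) (l : List (U × Δ.GraphMonoid)) :
    run (groupHom U Δ x) (some (g, l)) = some (g * x, l) := by
  induction x using LoopGraph.graphMonoid_induction generalizing g with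
  | one => rw [map_one, run_one, mul_one]
  | mul a x ih =>
    rw [map_mul, run_mul]
    exact (ih _).trans (by rw [mul_assoc])

theorem run_val (σ : Stack U Δ) : run (val σ) (some (1, [])) = some σ := by
  have base : ∀ l : List (U × Δ.GraphMonoid), run (baseVal l) (some (1, [])) = some (1, l) := by
    intro l
    induction l with
    | nil => exact run_one _
    | cons p l ih =>
      rcases p with ⟨a, h⟩
      rw [baseVal, run_mul, run_mul, ih, run_groupHom, run_eval_singleton, Option.bind_some,
        act_push, one_mul]
  rcases σ with ⟨g, l⟩
  rw [val, run_mul, base, run_groupHom, one_mul]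

/-- Every right-invertible element is the value of a stack. -/
theorem exists_val_eq {x : (pdGraph U Δ).GraphMonoid} (hx : x ∈ (pdGraph U Δ).RInv) :
    ∃ σ : Stack U Δ, val σ = x := by
  obtain ⟨y, hy⟩ := hx
  rcases h : run x (some ((1, []) : Stack U Δ)) with _ | σ
  · have := run_one (some ((1, []) : Stack U Δ))
    rw [← hy, run_mul, h, run_none] at this
    simp at this
  · exact ⟨σ, by rw [val_of_run h, val_nil, one_mul]⟩

/-- If a letter preserves right-invertibility, then it does not fail on the stack. -/
theorem exists_act_eq_some {σ : Stack U Δ} {a : Letter (U ⊕ W)}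
    (h : val σ * (pdGraph U Δ).eval [a] ∈ (pdGraph U Δ).RInv) : ∃ τ, act a σ = some τ := by
  obtain ⟨y, hy⟩ := h
  rcases h : act a σ with _ | τ
  · have := run_one (some ((1, []) : Stack U Δ))
    rw [← hy, run_mul, run_mul, run_val, run_eval_singleton, Option.bind_some, h, run_none] at this
    simp at this
  · exact ⟨τ, rfl⟩

theorem val_mem_rInv (hΔ : Δ.IsGrp) (σ : Stack U Δ) : val σ ∈ (pdGraph U Δ).RInv := by
  have hg : ∀ g : Δ.GraphMonoid, ∃ h, g * h = 1 := fun g => by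
    obtain ⟨w, rfl⟩ := LoopGraph.exists_eval_eq g
    obtain ⟨y, -, hy⟩ := hΔ.exists_mul_eval_eq_one w
    exact ⟨_, hy⟩
  have mul : ∀ x y : (pdGraph U Δ).GraphMonoid, (∃ z, x * z = 1) → (∃ z, y * z = 1) →
      ∃ z, x * y * z = 1 := by
    rintro x y ⟨x', hx⟩ ⟨y', hy⟩
    exact ⟨y' * x', by rw [mul_assoc, ← mul_assoc y, hy, one_mul, hx]⟩
  have grp : ∀ g, ∃ z, groupHom U Δ g * z = 1 := fun g => by
    obtain ⟨h, hh⟩ := hg g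
    exact ⟨groupHom U Δ h, by rw [← map_mul, hh, map_one]⟩
  rcases σ with ⟨g, l⟩
  refine mul _ _ ?_ (grp g)
  induction l with
  | nil => exact ⟨1, mul_one _⟩
  | cons p l ih => exact mul _ _ (mul _ _ ih (grp _)) ⟨_, LoopGraph.eval_cancel _⟩

end Stack

end Stack

/-! ### Letter games and small stacks -/

section LetterGame

variable {U : Type u} {W : Type v} {Δ : LoopGraph W} {S : Type w}

/-- The effect of at most one letter on a stack. -/
noncomputable def Stack.actOption : Option (Letter (U ⊕ W)) → Stack U Δ → Option (Stack U Δ)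
  | none, σ => some σ
  | some x, σ => σ.act x

theorem Stack.actOption_pop_eq_some_iff {a : U} {σ τ : Stack U Δ} :
    actOption (some (.inl a, false)) σ = some τ ↔ σ = (1, (a, τ.1) :: τ.2) :=
  act_pop_eq_some_iff

/-- A letter acts in the same way if the stack is put on top of another one. -/
theorem Stack.actOption_append {x : Option (Letter (U ⊕ W))} {g : Δ.GraphMonoid}
    {u : List (U × Δ.GraphMonoid)} {τ : Stack U Δ} (h : actOption x (g, u) = some τ)
    (l : List (U × Δ.GraphMonoid)) : actOption x (g, u ++ l) = some (τ.1, τ.2 ++ l) := by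
  rcases x with _ | ⟨a | c, _ | _⟩
  · obtain rfl := Option.some.inj h
    rfl
  · obtain ⟨rfl, rfl⟩ := Prod.mk.inj (actOption_pop_eq_some_iff.1 h)
    exact actOption_pop_eq_some_iff.2 rfl
  all_goals
    obtain rfl := Option.some.inj h
    rfl

/-- A letter that acts on a stack `u` put on top of `l` acts on `u`, or it pops the topmost letter
of `l`. -/
theorem Stack.actOption_append_cases {x : Option (Letter (U ⊕ W))} {g : Δ.GraphMonoid}
    {u l : List (U × Δ.GraphMonoid)} {τ : Stack U Δ} (h : actOption x (g, u ++ l) = some τ) :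
    (∃ σ, actOption x (g, u) = some σ ∧ τ = (σ.1, σ.2 ++ l)) ∨
      ∃ a, x = some (.inl a, false) ∧ g = 1 ∧ u = [] ∧ l = (a, τ.1) :: τ.2 := by
  rcases x with _ | ⟨a | c, _ | _⟩
  · exact .inl ⟨_, rfl, (Option.some.inj h).symm⟩
  · obtain ⟨h1, h2⟩ := Prod.mk.inj (actOption_pop_eq_some_iff.1 h)
    rcases u with _ | ⟨p, u⟩
    · exact .inr ⟨a, rfl, h1, rfl, h2⟩
    · obtain ⟨rfl, h3⟩ := List.cons.inj h2
      refine .inl ⟨(τ.1, u), actOption_pop_eq_some_iff.2 ?_, Prod.ext rfl h3.symm⟩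
      obtain rfl : g = 1 := h1
      rfl
  all_goals exact .inl ⟨_, rfl, (Option.some.inj h).symm⟩

/-- A game in which each move processes at most one letter. -/
structure LetterGame (U : Type u) (W : Type v) (S : Type w) where
  owner : S → Player
  moves : S → Set (Option (Letter (U ⊕ W)) × S)

namespace LetterGame

/-- From the stack `σ`, the move `m` leads into the set `X` of configurations, or pops some letter
`a` from below the stack, where this is only allowed into the states in `T a`. -/
def Good (T : U → Set S) (X : Set (S × Stack U Δ)) (σ : Stack U Δ)
    (m : Option (Letter (U ⊕ W)) × S) : Prop :=
  (∃ τ, σ.actOption m.1 = some τ ∧ (m.2, τ) ∈ X) ∨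
    ∃ a, m.1 = some (.inl a, false) ∧ σ = (1, []) ∧ m.2 ∈ T a

theorem Good.mono {T T' : U → Set S} {X X' : Set (S × Stack U Δ)} {σ : Stack U Δ}
    {m : Option (Letter (U ⊕ W)) × S} (h : Good T X σ m) (hT : T ≤ T') (hX : X ⊆ X') :
    Good T' X' σ m := by
  rcases h with ⟨τ, h, hτ⟩ | ⟨a, h, hσ, ha⟩
  · exact .inl ⟨τ, h, hX hτ⟩
  · exact .inr ⟨a, h, hσ, hT a ha⟩

/-- The existential player can keep the play inside `X` until a letter from below the stack is
popped in accordance with `T`. -/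
structure Stay (L : LetterGame U W S) (T : U → Set S) (X : Set (S × Stack U Δ)) : Prop where
  existential : ∀ s σ, (s, σ) ∈ X → L.owner s = .existential → ∃ m ∈ L.moves s, Good T X σ m
  universal : ∀ s σ, (s, σ) ∈ X → L.owner s = .universal → ∀ m ∈ L.moves s, Good T X σ m

/-- The winning configurations: the existential player avoids failures forever or until a letter
from below the stack is popped in accordance with `T`. -/
def Win (L : LetterGame U W S) (T : U → Set S) : Set (S × Stack U Δ) :=
  {c | ∃ X, L.Stay T X ∧ c ∈ X}

variable {L : LetterGame U W S} {T T' : U → Set S} {X X' : Set (S × Stack U Δ)}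

theorem Stay.subset_win (h : L.Stay T X) : X ⊆ L.Win T := fun _ hc => ⟨X, h, hc⟩

/-- It suffices to imitate the moves that are good in another set. -/
theorem Stay.imitate (h : L.Stay T X)
    (H : ∀ s σ, (s, σ) ∈ X' → ∃ σ', (s, σ') ∈ X ∧ ∀ m, Good T X σ' m → Good T' X' σ m) :
    L.Stay T' X' := by
  refine ⟨fun s σ hs ho => ?_, fun s σ hs ho m hm => ?_⟩
  · obtain ⟨σ', hσ', hm⟩ := H s σ hs
    obtain ⟨m, hm', hg⟩ := h.existential s σ' hσ' ho
    exact ⟨m, hm', hm m hg⟩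
  · obtain ⟨σ', hσ', hm'⟩ := H s σ hs
    exact hm' m (h.universal s σ' hσ' ho m hm)

theorem Stay.mono (h : L.Stay T X) (hT : T ≤ T') : L.Stay T' X :=
  h.imitate fun _ σ hs => ⟨σ, hs, fun _ hm => hm.mono hT subset_rfl⟩

theorem win_mono (hT : T ≤ T') : (L.Win T : Set (S × Stack U Δ)) ⊆ L.Win T' :=
  fun _ ⟨X, hX, hc⟩ => ⟨X, hX.mono hT, hc⟩

theorem stay_win (L : LetterGame U W S) (T : U → Set S) :
    L.Stay T (L.Win T : Set (S × Stack U Δ)) where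
  existential := fun s σ ⟨X, hX, hc⟩ ho => by
    obtain ⟨m, hm, hg⟩ := hX.existential s σ hc ho
    exact ⟨m, hm, hg.mono le_rfl hX.subset_win⟩
  universal := fun s σ ⟨X, hX, hc⟩ ho m hm =>
    (hX.universal s σ hc ho m hm).mono le_rfl hX.subset_win

/-- The states into which a letter may be popped from the top of `l`. -/
def exits (L : LetterGame U W S) (l : List (U × Δ.GraphMonoid)) : U → Set S :=
  fun b => {s | ∃ h t, l = (b, h) :: t ∧ (s, (h, t)) ∈ L.Win ⊥}

/-- The part `l` of a stack matters only through its exits. -/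
theorem append_mem_win_iff {s : S} {g : Δ.GraphMonoid} {u l : List (U × Δ.GraphMonoid)} :
    (s, (g, u ++ l)) ∈ L.Win ⊥ ↔ (s, (g, u)) ∈ L.Win (L.exits l) := by
  constructor
  · intro h
    refine Stay.subset_win (X := {c | (c.1, (c.2.1, c.2.2 ++ l)) ∈ L.Win ⊥})
      ((L.stay_win ⊥).imitate ?_) h
    rintro s ⟨g, u⟩ hs
    refine ⟨_, hs, ?_⟩
    rintro ⟨x, s'⟩ (⟨τ, hτ, hs'⟩ | ⟨a, -, -, ha⟩)
    · rcases Stack.actOption_append_cases hτ with ⟨σ, hσ, rfl⟩ | ⟨a, rfl, rfl, rfl, rfl⟩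
      · exact .inl ⟨σ, hσ, hs'⟩
      · exact .inr ⟨a, rfl, rfl, _, _, rfl, hs'⟩
    · exact ha.elim
  · intro h
    refine Stay.subset_win (X := {c | c ∈ L.Win ⊥ ∨ ∃ u, c.2.2 = u ++ l ∧
      (c.1, (c.2.1, u)) ∈ L.Win (L.exits l)}) ⟨?_, ?_⟩ (.inr ⟨u, rfl, h⟩)
    all_goals
      rintro s ⟨g, _⟩ (hs | ⟨u, rfl, hs⟩) ho
    · obtain ⟨m, hm, hg⟩ := (L.stay_win ⊥).existential _ _ hs ho
      exact ⟨m, hm, hg.mono le_rfl fun _ => .inl⟩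
    · obtain ⟨m, hm, hg⟩ := (L.stay_win _).existential _ _ hs ho
      refine ⟨m, hm, ?_⟩
      rcases hg with ⟨τ, hτ, hs'⟩ | ⟨a, hx, hσ, k, t, rfl, hs'⟩
      · exact .inl ⟨_, Stack.actOption_append hτ l, .inr ⟨_, rfl, hs'⟩⟩
      · obtain ⟨rfl, rfl⟩ := Prod.mk.inj hσ
        refine .inl ⟨(k, t), ?_, .inl hs'⟩
        rw [hx]
        exact Stack.actOption_pop_eq_some_iff.2 rfl
    · intro m hm
      exact ((L.stay_win ⊥).universal _ _ hs ho m hm).mono le_rfl fun _ => .inl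
    · intro m hm
      rcases (L.stay_win _).universal _ _ hs ho m hm with
        ⟨τ, hτ, hs'⟩ | ⟨a, hx, hσ, k, t, rfl, hs'⟩
      · exact .inl ⟨_, Stack.actOption_append hτ l, .inr ⟨_, rfl, hs'⟩⟩
      · obtain ⟨rfl, rfl⟩ := Prod.mk.inj hσ
        refine .inl ⟨(k, t), ?_, .inl hs'⟩
        rw [hx]
        exact Stack.actOption_pop_eq_some_iff.2 rfl

/-- Every word for the group element `g` has at least `d` letters. -/
def LongElement (d : ℕ) (g : Δ.GraphMonoid) : Prop := ∀ x, Δ.eval x = g → d ≤ x.length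

theorem LongElement.mul_letter (hΔ : Δ.IsGrp) {d : ℕ} {g : Δ.GraphMonoid}
    (h : LongElement (d + 1) g) (a : Letter W) : LongElement d (g * Δ.eval [a]) := by
  intro x hx
  have := h (x ++ [(a.1, !a.2)]) (by
    rw [LoopGraph.eval_append, hx, mul_assoc, hΔ.eval_mul_eval_not, mul_one])
  simpa using this

/-- The second stack arises from the first one if its group element at the bottom is replaced
by `g`. -/
inductive Rebase (g : Δ.GraphMonoid) : Stack U Δ → Stack U Δ → Prop
  | bottom (h : Δ.GraphMonoid) : Rebase g (h, []) (g, [])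
  | frame (k : Δ.GraphMonoid) (l : List (U × Δ.GraphMonoid)) (b : U) (h : Δ.GraphMonoid) :
    Rebase g (k, l ++ [(b, h)]) (k, l ++ [(b, g)])

/-- The states from which the existential player wins with a group element of length at least `d`
as her stack. -/
def longWin (L : LetterGame U W S) (Δ : LoopGraph W) (T : U → Set S) (d : ℕ) : Set S :=
  {s | ∃ g : Δ.GraphMonoid, LongElement d g ∧ (s, (g, [])) ∈ L.Win T}

theorem longWin_succ_subset (L : LetterGame U W S) (Δ : LoopGraph W) (T : U → Set S) (d : ℕ) :
    L.longWin Δ T (d + 1) ⊆ L.longWin Δ T d :=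
  fun _ ⟨g, hg, hs⟩ => ⟨g, fun x hx => (Nat.le_succ d).trans (hg x hx), hs⟩

/-- One move changes the length of the group element at the bottom by at most one, and nothing is
popped from below it while it is nontrivial. Hence, if `longWin` is the same set for `d` and for
`d + 1`, then the bottom can be considered as long forever. -/
theorem mem_win_bot_of_mem_longWin (hΔ : Δ.IsGrp) {d : ℕ}
    (hd : L.longWin Δ T d ⊆ L.longWin Δ T (d + 1)) {s : S} (hs : s ∈ L.longWin Δ T (d + 1)) :
    (s, ((1, []) : Stack U Δ)) ∈ L.Win ⊥ := by
  obtain ⟨g, hg, hs⟩ := hs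
  refine Stay.subset_win (X := {c | ∃ g σ, LongElement (d + 1) g ∧ Rebase g c.2 σ ∧
    (c.1, σ) ∈ L.Win T}) ((L.stay_win T).imitate ?_) ⟨g, _, hg, .bottom 1, hs⟩
  rintro s σ ⟨g, σ', hg, hσ, hs⟩
  have hg1 : g ≠ 1 := fun h => by simpa using hg [] h.symm
  refine ⟨σ', hs, ?_⟩
  dsimp only at hσ hs
  clear hs s
  rintro ⟨x, s⟩ (⟨τ, hτ, hs⟩ | ⟨a, -, hσ', -⟩)
  · refine .inl ?_
    dsimp only at hτ hs ⊢
    cases hσ with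
    | bottom h =>
      rcases x with _ | ⟨a | c, _ | _⟩
      · obtain rfl := Option.some.inj hτ
        exact ⟨_, rfl, g, _, hg, .bottom h, hs⟩
      · exact absurd (Prod.mk.inj (Stack.actOption_pop_eq_some_iff.1 hτ)).1 hg1
      · obtain rfl := Option.some.inj hτ
        exact ⟨_, rfl, g, _, hg, .frame 1 [] a h, hs⟩
      all_goals
        obtain rfl := Option.some.inj hτ
        -- The letter may have shortened the bottom element, but then `hd` yields a long one again.
        obtain ⟨g', hg', hs'⟩ := hd ⟨_, hg.mul_letter hΔ _, hs⟩
        exact ⟨_, rfl, g', _, hg', .bottom _, hs'⟩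
    | frame k l b h =>
      rcases Stack.actOption_append_cases hτ with ⟨σ, hσ, rfl⟩ | ⟨a, rfl, rfl, rfl, hl⟩
      · exact ⟨_, Stack.actOption_append hσ _, g, _, hg, .frame _ _ b h, hs⟩
      · obtain ⟨h1, h2⟩ := List.cons.inj hl
        obtain ⟨rfl, h3⟩ := Prod.mk.inj h1
        refine ⟨(h, []), Stack.actOption_pop_eq_some_iff.2 rfl, g, _, hg, .bottom h, ?_⟩
        rwa [h3, h2]
  · cases hσ with
    | bottom h => exact absurd (Prod.mk.inj hσ').1 hg1
    | frame k l b h => simp at hσ'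

/-- The sets `longWin` decrease with `d`, and they cannot do so strictly more often than there are
states. -/
theorem exists_longWin_subset [Fintype S] (L : LetterGame U W S) (Δ : LoopGraph W)
    (T : U → Set S) : ∃ d ≤ Fintype.card S, L.longWin Δ T d ⊆ L.longWin Δ T (d + 1) := by
  by_contra! H
  have key : ∀ d ≤ Fintype.card S + 1, (L.longWin Δ T d).ncard + d ≤ Fintype.card S := by
    intro d hd
    induction d with
    | zero => simpa [Nat.card_eq_fintype_card] using Set.ncard_le_card (L.longWin Δ T 0)
    | succ d ih =>
      have h1 := ih (by omega)
      have h2 : (L.longWin Δ T (d + 1)).ncard < (L.longWin Δ T d).ncard :=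
        Set.ncard_lt_ncard ⟨L.longWin_succ_subset Δ T d, H d (by omega)⟩ (Set.toFinite _)
      omega
  have := key _ le_rfl
  omega

/-- The group elements that are represented by words of length at most `n`. -/
def ShortElement (n : ℕ) (g : Δ.GraphMonoid) : Prop := ∃ x, Δ.eval x = g ∧ x.length ≤ n

theorem shortElement_one (n : ℕ) : ShortElement n (1 : Δ.GraphMonoid) := ⟨[], rfl, n.zero_le⟩

/-- A group element on top of the stack can be replaced by a short one. If it is longer than the
number of states, then the existential player can win without ever popping the letter below it, so
that `1` will do. -/
theorem exists_shortElement [Fintype S] (hΔ : Δ.IsGrp) (L : LetterGame U W S) (T : U → Set S)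
    (g : Δ.GraphMonoid) : ∃ g' : Δ.GraphMonoid, ShortElement (Fintype.card S) g' ∧
      ∀ s, (s, (g, [])) ∈ L.Win T → (s, (g', [])) ∈ L.Win T := by
  by_cases hg : ShortElement (Fintype.card S) g
  · exact ⟨g, hg, fun _ h => h⟩
  · obtain ⟨d, hd, hsub⟩ := L.exists_longWin_subset Δ T
    have hlong : LongElement (d + 1) g := fun x hx => by
      by_contra h
      exact hg ⟨x, hx, by omega⟩
    exact ⟨1, shortElement_one _, fun s hs =>
      win_mono bot_le (mem_win_bot_of_mem_longWin hΔ hsub ⟨g, hlong, hs⟩)⟩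

/-- The states from which the existential player wins with a given stack. -/
def winStates (L : LetterGame U W S) (σ : Stack U Δ) : Set S := {s | (s, σ) ∈ L.Win ⊥}

/-- The sets `winStates` of a stack and of all the stacks that remain after popping. -/
def winProfile (L : LetterGame U W S) : Δ.GraphMonoid → List (U × Δ.GraphMonoid) → List (Set S)
  | g, [] => [L.winStates (g, ([] : List (U × Δ.GraphMonoid)))]
  | g, (a, h) :: l => L.winStates (g, (a, h) :: l) :: winProfile L h l

theorem length_winProfile (g : Δ.GraphMonoid) (l : List (U × Δ.GraphMonoid)) :
    (L.winProfile g l).length = l.length + 1 := by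
  induction l generalizing g with
  | nil => rfl
  | cons p l ih => exact congrArg (· + 1) (ih p.2)

/-- All group elements of the stack are short. -/
def ShortStack (n : ℕ) (σ : Stack U Δ) : Prop :=
  ShortElement n σ.1 ∧ ∀ p ∈ σ.2, ShortElement n p.2

theorem shortStack_cons {n : ℕ} {g h : Δ.GraphMonoid} {a : U} {l : List (U × Δ.GraphMonoid)} :
    ShortStack n (g, (a, h) :: l) ↔ ShortElement n g ∧ ShortStack n (h, l) := by
  simp [ShortStack]

/-- Cutting a stack down to the substack that has the given winning states. -/
theorem exists_of_mem_winProfile {n : ℕ} {A : Set S} (l : List (U × Δ.GraphMonoid)) :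
    ∀ h, A ∈ L.winProfile h l → (L.winProfile h l).Nodup → ShortStack n (h, l) →
      ∃ (h' : Δ.GraphMonoid) (l' : List (U × Δ.GraphMonoid)),
        L.winStates (h', l') = A ∧ (L.winProfile h' l').Nodup ∧ ShortStack n (h', l') := by
  induction l with
  | nil =>
    intro h hA hl hn
    exact ⟨h, [], (List.mem_singleton.1 hA).symm, hl, hn⟩
  | cons p l ih =>
    intro h hA hl hn
    rcases List.mem_cons.1 hA with rfl | hA
    · exact ⟨h, p :: l, rfl, hl, hn⟩
    · exact ih p.2 hA (List.nodup_cons.1 hl).2 (shortStack_cons.1 hn).2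

/-- Each stack can be replaced by one with short group elements in which no two substacks have the
same winning states: if they had, then the part between them could be cut out. -/
theorem exists_nodup_winProfile [Fintype S] (hΔ : Δ.IsGrp) (L : LetterGame U W S)
    (l : List (U × Δ.GraphMonoid)) : ∀ g, ∃ (g' : Δ.GraphMonoid) (l' : List (U × Δ.GraphMonoid)),
      L.winStates (g, l) ⊆ L.winStates (g', l') ∧
      (L.winProfile g' l').Nodup ∧ ShortStack (Fintype.card S) (g', l') := by
  induction l with
  | nil =>
    intro g
    obtain ⟨g', hg', hs⟩ := exists_shortElement hΔ L ⊥ g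
    exact ⟨g', [], hs, List.nodup_singleton _, hg', by simp⟩
  | cons p l ih =>
    rcases p with ⟨a, h⟩
    intro g
    obtain ⟨h', l', hsub, hl', hn⟩ := ih h
    obtain ⟨g', hg', hs⟩ := exists_shortElement hΔ L (L.exits ((a, h') :: l')) g
    have hle : L.exits ((a, h) :: l) ≤ L.exits ((a, h') :: l') := by
      rintro b s ⟨k, t, hk, hs⟩
      obtain ⟨⟨rfl, rfl⟩, rfl⟩ : (a = b ∧ h = k) ∧ l = t := by simpa using hk
      exact ⟨_, _, rfl, hsub hs⟩
    have hwin : L.winStates (g, (a, h) :: l) ⊆ L.winStates (g', (a, h') :: l') := by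
      intro s hs'
      have h1 := (append_mem_win_iff (u := [])).1 hs'
      exact (append_mem_win_iff (u := [])).2 (hs s (win_mono hle h1))
    by_cases hmem : L.winStates (g', (a, h') :: l') ∈ L.winProfile h' l'
    · obtain ⟨h'', l'', heq, hl'', hn''⟩ := exists_of_mem_winProfile l' h' hmem hl' hn
      exact ⟨h'', l'', hwin.trans heq.ge, hl'', hn''⟩
    · exact ⟨g', _, hwin, List.nodup_cons.2 ⟨hmem, hl'⟩, shortStack_cons.2 ⟨hg', hn⟩⟩

/-- A winning stack can be replaced by one whose height is less than the number of sets of states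
and whose group elements are not longer than the number of states. -/
theorem exists_small_stack [Fintype S] (hΔ : Δ.IsGrp) (L : LetterGame U W S) {s : S}
    {σ : Stack U Δ} (hs : (s, σ) ∈ L.Win ⊥) : ∃ τ : Stack U Δ, (s, τ) ∈ L.Win ⊥ ∧
      τ.2.length < 2 ^ Fintype.card S ∧ ShortStack (Fintype.card S) τ := by
  classical
  obtain ⟨g', l', hsub, hl', hn⟩ := exists_nodup_winProfile hΔ L σ.2 σ.1
  refine ⟨(g', l'), hsub hs, ?_, hn⟩
  have := hl'.length_le_card
  rw [length_winProfile, Fintype.card_set] at this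
  exact this

end LetterGame

end LetterGame

/-! ### The letter game of an arena -/

namespace Arena

variable {U : Type u} {W : Type v} {Δ : LoopGraph W} {Q : Type w}

/-- The states after each transition is cut into transitions that carry at most one letter: the
given states, and for each transition one state between any two successive letters. -/
abbrev LetterState (G : Arena (pdGraph U Δ) Q) : Type w :=
  Q ⊕ Σ e : G.Edge, Fin (e.word.length - 1)

theorem card_letterState [Fintype Q] (G : Arena (pdGraph U Δ) Q) :
    Fintype.card G.LetterState = G.param := by
  simp [param]

/-- The state that is entered when the letter number `k` of a transition (counted from zero) is
processed. If the label is empty, then the whole transition is the letter number `0`. -/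
def letterTarget {G : Arena (pdGraph U Δ) Q} (e : G.Edge) (k : ℕ) : G.LetterState :=
  if h : k < e.word.length - 1 then .inr ⟨e, k, h⟩ else .inl e.1.2

/-- The game in which the transitions of the arena are processed letter by letter. -/
def letterGame (G : Arena (pdGraph U Δ) Q) : LetterGame U W G.LetterState where
  owner
    | .inl q => G.owner q
    | .inr _ => .existential
  moves
    | .inl q => {m | ∃ e : G.Edge, e.1.1 = q ∧ m = (e.word[0]?, letterTarget e 0)}
    | .inr ⟨e, k⟩ => {(e.word[k.1 + 1]?, letterTarget e (k.1 + 1))}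

theorem Edge.trans_eq {V : Type u} {Γ : LoopGraph V} {G : Arena Γ Q} (e : G.Edge) :
    G.trans e.1.1 e.1.2 = some e.word := by
  simp [Edge.word]

theorem exists_edge_of_trans_eq {V : Type u} {Γ : LoopGraph V} {G : Arena Γ Q} {p q : Q}
    {y : List (Letter V)} (h : G.trans p q = some y) :
    ∃ e : G.Edge, e.1 = (p, q) ∧ e.word = y :=
  ⟨⟨(p, q), by simp [h]⟩, rfl, by simp [Edge.word, h]⟩

variable {G : Arena (pdGraph U Δ) Q}

/-- A viable set of the arena gives winning configurations of the letter game: while a transition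
is being processed, it suffices that its remaining letters lead into the viable set. -/
theorem Viable.mem_win {Y : Set G.Conf} (hY : G.Viable Y) {q : Q} {σ : Stack U Δ}
    (hq : (q, σ.val) ∈ Y) : (.inl q, σ) ∈ G.letterGame.Win ⊥ := by
  let X : Set (G.LetterState × Stack U Δ) := {c | match c.1 with
    | .inl q => (q, c.2.val) ∈ Y
    | .inr ⟨e, k⟩ => (e.1.2, c.2.val * (pdGraph U Δ).eval (e.word.drop (k.1 + 1))) ∈ Y}
  have key : ∀ (e : G.Edge) (k : ℕ) (σ : Stack U Δ),
      (e.1.2, σ.val * (pdGraph U Δ).eval (e.word.drop k)) ∈ Y →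
      LetterGame.Good ⊥ X σ (e.word[k]?, letterTarget e k) := by
    intro e k σ h
    refine .inl ?_
    by_cases hk : k < e.word.length
    · rw [List.drop_eq_getElem_cons hk, LoopGraph.eval_cons, ← mul_assoc] at h
      obtain ⟨τ, hτ⟩ := Stack.exists_act_eq_some (LoopGraph.mem_rInv_of_mul (hY.rInv _ _ h))
      rw [← Stack.val_of_act hτ] at h
      refine ⟨τ, by rw [List.getElem?_eq_getElem hk]; exact hτ, ?_⟩
      by_cases hk' : k < e.word.length - 1
      · simpa [letterTarget, hk', X] using h
      · rw [List.drop_eq_nil_of_le (by omega), LoopGraph.eval_nil, mul_one] at h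
        simpa [letterTarget, hk', X] using h
    · rw [List.drop_eq_nil_of_le (by omega), LoopGraph.eval_nil, mul_one] at h
      refine ⟨σ, by rw [List.getElem?_eq_none (by omega)]; rfl, ?_⟩
      have hk' : ¬ k < e.word.length - 1 := by omega
      simpa [letterTarget, hk', X] using h
  refine LetterGame.Stay.subset_win (X := X) ⟨?_, ?_⟩ hq
  · rintro (q | ⟨e, k⟩) σ hs ho
    · obtain ⟨r, y, hy, hr⟩ := hY.existential q _ hs ho
      obtain ⟨e, he, rfl⟩ := exists_edge_of_trans_eq hy
      obtain ⟨rfl, rfl⟩ := Prod.ext_iff.1 he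
      exact ⟨_, ⟨e, rfl, rfl⟩, key e 0 σ hr⟩
    · exact ⟨_, rfl, key e _ σ hs⟩
  · rintro (q | ⟨e, k⟩) σ hs ho m hm
    · obtain ⟨e, rfl, rfl⟩ := hm
      exact key e 0 σ (hY.universal _ _ hs ho _ _ e.trans_eq)
    · cases ho

/-- A transition that is begun while winning in the letter game can be completed: its letters from
number `k` on lead to a winning configuration. -/
theorem mem_win_of_good {e : G.Edge} {k : ℕ} {σ : Stack U Δ} (hk : k ≤ e.word.length)
    (h : LetterGame.Good ⊥ (G.letterGame.Win ⊥) σ (e.word[k]?, letterTarget e k)) :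
    ∃ τ : Stack U Δ, σ.val * (pdGraph U Δ).eval (e.word.drop k) = τ.val ∧
      (.inl e.1.2, τ) ∈ G.letterGame.Win ⊥ := by
  induction hd : e.word.length - k generalizing k σ with
  | zero =>
    obtain ⟨τ, hτ, hs⟩ := h.resolve_right fun ⟨_, _, _, ha⟩ => ha
    have hk' : ¬ k < e.word.length - 1 := by omega
    rw [List.getElem?_eq_none (by omega)] at hτ
    obtain rfl := Option.some.inj hτ
    refine ⟨σ, by rw [List.drop_eq_nil_of_le (by omega), LoopGraph.eval_nil, mul_one], ?_⟩
    simpa [letterTarget, hk'] using hs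
  | succ d ih =>
    obtain ⟨τ, hτ, hs⟩ := h.resolve_right fun ⟨_, _, _, ha⟩ => ha
    have hk : k < e.word.length := by omega
    rw [List.getElem?_eq_getElem hk] at hτ
    rw [List.drop_eq_getElem_cons hk, LoopGraph.eval_cons, ← mul_assoc,
      ← Stack.val_of_act (show Stack.act _ σ = some τ from hτ)]
    by_cases hk' : k < e.word.length - 1
    · simp only [letterTarget, dif_pos hk'] at hs
      obtain ⟨m, rfl, hm⟩ := (G.letterGame.stay_win ⊥).existential _ _ hs rfl
      exact ih (by omega) hm (by omega)
    · simp only [letterTarget, dif_neg hk'] at hs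
      exact ⟨τ, by rw [List.drop_eq_nil_of_le (by omega), LoopGraph.eval_nil, mul_one], hs⟩

theorem viable_of_win (hΔ : Δ.IsGrp) (G : Arena (pdGraph U Δ) Q) :
    G.Viable {c | ∃ σ : Stack U Δ, c.2 = σ.val ∧ (.inl c.1, σ) ∈ G.letterGame.Win ⊥} where
  rInv := by
    rintro q _ ⟨σ, rfl, -⟩
    exact σ.val_mem_rInv hΔ
  existential := by
    rintro q _ ⟨σ, rfl, hs⟩ ho
    obtain ⟨_, ⟨e, rfl, rfl⟩, hm⟩ := (G.letterGame.stay_win ⊥).existential _ _ hs ho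
    exact ⟨_, _, e.trans_eq, mem_win_of_good (k := 0) (Nat.zero_le _) hm⟩
  universal := by
    rintro q _ ⟨σ, rfl, hs⟩ ho r y hy
    obtain ⟨e, he, rfl⟩ := exists_edge_of_trans_eq hy
    obtain ⟨rfl, rfl⟩ := Prod.ext_iff.1 he
    exact mem_win_of_good (k := 0) (Nat.zero_le _)
      ((G.letterGame.stay_win ⊥).universal _ _ hs ho _ ⟨e, rfl, rfl⟩)

/-- If the existential player wins with some initial credit, then she wins with a small one. -/
theorem UV.exists_small_stack [Fintype Q] (hΔ : Δ.IsGrp) (h : G.UV) :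
    ∃ (Y : Set G.Conf) (τ : Stack U Δ), G.Viable Y ∧ (G.init, τ.val) ∈ Y ∧
      τ.2.length < 2 ^ G.param ∧ LetterGame.ShortStack G.param τ := by
  obtain ⟨x, hx⟩ := h
  obtain ⟨Y, hY, hq⟩ := existsWins_iff_exists_viable.1 hx
  obtain ⟨σ, hσ⟩ := Stack.exists_val_eq (hY.rInv _ _ hq)
  rw [← hσ] at hq
  obtain ⟨τ, hτ, hlen, hshort⟩ := LetterGame.exists_small_stack hΔ _ (hY.mem_win hq)
  rw [card_letterState] at hlen hshort
  exact ⟨_, τ, viable_of_win hΔ G, ⟨τ, rfl, hτ⟩, hlen, hshort⟩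

end Arena

/-! ### Configurations of the arena with guessing -/

section Guess

variable {U : Type u} {W : Type v} {Δ : LoopGraph W} {Q : Type w} {n : ℕ}

/-- The stack of the arena with guessing: the bottom symbol, and above it pushdown letters with
indices. -/
def Stack.withBottom (σ : Stack (U × Fin n) Δ) : Stack (Option (U × Fin n)) Δ :=
  (σ.1, σ.2.map (fun p => (some p.1, p.2)) ++ [(none, 1)])

/-- The stack of the given arena, without bottom symbol and indices. -/
def Stack.forget (σ : Stack (U × Fin n) Δ) : Stack U Δ := (σ.1, σ.2.map fun p => (p.1.1, p.2))

/-- The monoid element of a stack with indices in the arena with guessing. -/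
def Stack.guessVal (σ : Stack (U × Fin n) Δ) : (pdGraph (Option (U × Fin n)) Δ).GraphMonoid :=
  σ.withBottom.val

/-- The word of indices in a stack, from top to bottom. -/
def indices (l : List ((U × Fin n) × Δ.GraphMonoid)) : List (Fin n) := l.map fun p => p.1.2

namespace Stack

theorem guessVal_of_act {x : Letter (Option (U × Fin n) ⊕ W)} {σ τ : Stack (U × Fin n) Δ}
    (h : act x σ.withBottom = some τ.withBottom) :
    σ.guessVal * (pdGraph (Option (U × Fin n)) Δ).eval [x] = τ.guessVal :=
  (val_of_act h).symm

theorem guessVal_push (p : U × Fin n) (σ : Stack (U × Fin n) Δ) :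
    σ.guessVal * (pdGraph (Option (U × Fin n)) Δ).eval [(.inl (some p), true)] =
      guessVal (1, (p, σ.1) :: σ.2) :=
  guessVal_of_act rfl

theorem guessVal_pop (p : U × Fin n) (h : Δ.GraphMonoid)
    (l : List ((U × Fin n) × Δ.GraphMonoid)) :
    guessVal (1, (p, h) :: l) * (pdGraph (Option (U × Fin n)) Δ).eval [(.inl (some p), false)] =
      guessVal (h, l) :=
  guessVal_of_act (act_pop_eq_some_iff.2 rfl)

theorem val_mul_groupWord {U : Type u} (σ : Stack (Option (U × Fin n)) Δ) (o : Option (Letter W)) :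
    σ.val * (pdGraph (Option (U × Fin n)) Δ).eval (groupWord o) =
      val (σ.1 * Δ.eval o.toList, σ.2) := by
  rcases o with _ | x
  · rw [groupWord, LoopGraph.eval_nil, mul_one, Option.toList_none, LoopGraph.eval_nil, mul_one]
  · exact (val_of_act rfl).symm

theorem guessVal_mul_groupWord (σ : Stack (U × Fin n) Δ) (o : Option (Letter W)) :
    σ.guessVal * (pdGraph (Option (U × Fin n)) Δ).eval (groupWord o) =
      guessVal (σ.1 * Δ.eval o.toList, σ.2) :=
  val_mul_groupWord _ o

/-- Each letter that acts on the stack without indices also acts on the stack with indices, for a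
suitable index of the letter. -/
theorem exists_act_copyLetter (hn : 0 < n) {x : Letter (U ⊕ W)} {σ : Stack (U × Fin n) Δ}
    {τ : Stack U Δ} (h : act x σ.forget = some τ) :
    ∃ (i : Fin n) (σ' : Stack (U × Fin n) Δ),
      act (copyLetter i x) σ.withBottom = some σ'.withBottom ∧ σ'.forget = τ := by
  rcases x with ⟨a | c, _ | _⟩
  · obtain ⟨h1, h2⟩ := Prod.mk.inj (act_pop_eq_some_iff.1 h)
    rcases σ with ⟨g, _ | ⟨⟨⟨b, i⟩, k⟩, l⟩⟩
    · simp at h2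
    · obtain rfl : g = 1 := h1
      obtain ⟨⟨rfl, rfl⟩, h3⟩ : (b = a ∧ k = τ.1) ∧ _ = τ.2 := by simpa using h2
      exact ⟨i, (τ.1, l), act_pop_eq_some_iff.2 rfl, Prod.ext rfl h3⟩
  · exact ⟨⟨0, hn⟩, (1, ((a, ⟨0, hn⟩), σ.1) :: σ.2), rfl, Option.some.inj h⟩
  all_goals exact ⟨⟨0, hn⟩, (σ.1 * Δ.eval [(c, _)], σ.2), rfl, Option.some.inj h⟩

/-- The stack `τ` remains if letters are popped from `σ`, disregarding their topmost group
elements. -/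
inductive Substack {U : Type u} (σ : Stack U Δ) : Stack U Δ → Prop
  | refl : Substack σ σ
  | pop {g h : Δ.GraphMonoid} {a : U} {l : List (U × Δ.GraphMonoid)} :
    Substack σ (g, (a, h) :: l) → Substack σ (h, l)

theorem exists_substack_nil (l : List (U × Δ.GraphMonoid)) (g : Δ.GraphMonoid) {σ : Stack U Δ}
    (h : Substack σ (g, l)) : ∃ g, Substack σ (g, []) := by
  induction l generalizing g with
  | nil => exact ⟨g, h⟩
  | cons p l ih => exact ih p.2 h.pop

theorem Substack.shortStack {σ τ : Stack U Δ} (h : Substack σ τ)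
    (hσ : LetterGame.ShortStack n σ) : LetterGame.ShortStack n τ := by
  induction h with
  | refl => exact hσ
  | pop _ ih => exact (LetterGame.shortStack_cons.1 ih).2

theorem Substack.indices_mem {σ τ : Stack (U × Fin n) Δ} (h : Substack σ τ)
    (hσ : indices σ.2 ∈ guardLanguage n) : indices τ.2 ∈ guardLanguage n := by
  induction h with
  | refl => exact hσ
  | @pop g h p l _ ih => exact mem_guardLanguage_of_append (x := [p.2]) ih

/-- A stack of height less than `2 ^ n` can be given indices that are not rejected by any guard. -/
theorem exists_forget_eq {σ : Stack U Δ} (h : σ.2.length < 2 ^ n) :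
    ∃ τ : Stack (U × Fin n) Δ, τ.forget = σ ∧ indices τ.2 ∈ guardLanguage n := by
  obtain ⟨x, hx, hlen⟩ := exists_mem_guardLanguage_length_eq h
  refine ⟨(σ.1, (σ.2.zip x).map fun p => ((p.1.1, p.2), p.1.2)), Prod.ext rfl ?_, ?_⟩
  · have : (σ.2.zip x).map Prod.fst = σ.2 := List.map_fst_zip hlen.ge
    simpa [forget, List.map_map, Function.comp_def] using this
  · have : (σ.2.zip x).map Prod.snd = x := List.map_snd_zip hlen.le
    simpa [indices, List.map_map, Function.comp_def, this] using hx

theorem shortStack_of_forget {m : ℕ} {σ : Stack (U × Fin n) Δ}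
    (h : LetterGame.ShortStack m σ.forget) : LetterGame.ShortStack m σ :=
  ⟨h.1, fun _ hp => h.2 _ (List.mem_map_of_mem hp)⟩

end Stack

namespace Arena

variable [Fintype Q] {G : Arena (pdGraph U Δ) Q}

/-! ### From an initial credit to a guess -/

open Stack

/-- The configurations of the arena with guessing that occur if the existential player guesses the
stack `σ` and continues in the given arena inside the viable set `Y`. On the chains that collect or
cancel a group element, `x` is a word that remains to be processed. -/
inductive GuessInv (Y : Set G.Conf) (σ : Stack (U × Fin G.param) Δ) :
    GuessState G G.param → (pdGraph (Option (U × Fin G.param)) Δ).GraphMonoid → Prop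
  | start : GuessInv Y σ .start 1
  | pick (j : Fin (G.param + 1)) (τ : Stack (U × Fin G.param) Δ) (x : List (Letter W))
    (hτ : Substack σ (τ.1 * Δ.eval x, τ.2)) (hx : x.length + j ≤ G.param) :
    GuessInv Y σ (.pick j) τ.guessVal
  | challenge (τ : Stack (U × Fin G.param) Δ) (hτ : Substack σ τ) :
    GuessInv Y σ .challenge (guessVal (1, τ.2))
  | read (i : Fin G.param) (b : Bool) (j : Fin (G.param + 1)) (τ : Stack (U × Fin G.param) Δ)
    (x : List (Letter W)) (h1 : τ.1 * Δ.eval x = 1) (hx : x.length + j ≤ G.param)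
    (hτ : ∀ p ∈ τ.2, LetterGame.ShortElement G.param p.2)
    (hi : (guard i).evalFrom (some b) (indices τ.2) ≠ none) :
    GuessInv Y σ (.read i b j) τ.guessVal
  | happy (x) (hx : x ∈ LoopGraph.RInv _) : GuessInv Y σ .happy x
  | game (q : Q) (τ : Stack (U × Fin G.param) Δ) (h : (q, τ.forget.val) ∈ Y) :
    GuessInv Y σ (.game q) τ.guessVal
  | mid (e : G.Edge) (k : Fin (e.word.length + 1)) (τ : Stack (U × Fin G.param) Δ)
    (h : (e.1.2, τ.forget.val * (pdGraph U Δ).eval (e.word.drop k)) ∈ Y) :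
    GuessInv Y σ (.mid e k) τ.guessVal

variable {Y : Set G.Conf} {σ : Stack (U × Fin G.param) Δ}

theorem GuessInv.rInv (hΔ : Δ.IsGrp) {s : GuessState G G.param} {x} (h : GuessInv Y σ s x) :
    x ∈ (pdGraph (Option (U × Fin G.param)) Δ).RInv := by
  cases h with
  | start => exact ⟨1, mul_one 1⟩
  | happy _ hx => exact hx
  | _ => exact val_mem_rInv hΔ _

variable [DecidableEq Q] [DecidableEq U] [DecidableEq W]

/-- Viability in the arena with guessing can be checked without its subdividing states. They belong
to the existential player, who has only one move there. -/
theorem viable_guess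
    {I : GuessState G G.param → (pdGraph (Option (U × Fin G.param)) Δ).GraphMonoid → Prop}
    (rInv : ∀ s x, I s x → x ∈ (pdGraph (Option (U × Fin G.param)) Δ).RInv)
    (existential : ∀ s x, I s x → (guess G).owner (.inl s) = .existential →
      ∃ e : GuessEdge G G.param, e.data.1 = s ∧ I e.data.2.2 (x * LoopGraph.eval _ e.data.2.1))
    (universal : ∀ (e : GuessEdge G G.param) x, I e.data.1 x →
      (guess G).owner (.inl e.data.1) = .universal →
      I e.data.2.2 (x * LoopGraph.eval _ e.data.2.1)) :
    (guess G).Viable {c | match c.1 with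
      | .inl s => I s c.2
      | .inr e => I e.data.2.2 c.2} where
  rInv := by
    rintro (s | e) x hs
    · exact rInv _ _ hs
    · exact rInv _ _ hs
  existential := by
    rintro (s | e) x hs ho
    · obtain ⟨e, rfl, he⟩ := existential s x hs ho
      exact ⟨.inr e, _, if_pos rfl, he⟩
    · refine ⟨.inl e.data.2.2, _, if_pos rfl, ?_⟩
      rw [LoopGraph.eval_nil, mul_one]
      exact hs
  universal := by
    rintro (s | e) x hs ho (r | f) y hy
    · cases hy
    · have hy : (if f.data.1 = s then some f.data.2.1 else none) = some y := hy
      split_ifs at hy with h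
      obtain rfl := Option.some.inj hy
      subst h
      exact universal f x hs ho
    · cases ho
    · cases hy

theorem Viable.exists_guessEdge {Y : Set (guess G).Conf} (hY : (guess G).Viable Y)
    {s : GuessState G G.param} {x} (hs : (.inl s, x) ∈ Y)
    (ho : (guess G).owner (.inl s) = .existential) : ∃ e : GuessEdge G G.param, e.data.1 = s ∧
      (.inl e.data.2.2, x * LoopGraph.eval _ e.data.2.1) ∈ Y := by
  obtain ⟨r, y, hy, hr⟩ := hY.existential _ _ hs ho
  rcases r with r | e
  · cases hy
  · have hy : (if e.data.1 = s then some e.data.2.1 else none) = some y := hy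
    split_ifs at hy with h
    obtain rfl := Option.some.inj hy
    refine ⟨e, h, ?_⟩
    obtain ⟨r, y, hy, hr⟩ := hY.existential _ _ hr rfl
    rcases r with r | f
    · have hy : (if e.data.2.2 = r then some [] else none) = some y := hy
      split_ifs at hy with h
      obtain rfl := Option.some.inj hy
      rw [h]
      simpa [LoopGraph.eval_nil] using hr
    · cases hy

theorem Viable.guessEdge_mem {Y : Set (guess G).Conf} (hY : (guess G).Viable Y)
    (e : GuessEdge G G.param) {x} (hs : (.inl e.data.1, x) ∈ Y)
    (ho : (guess G).owner (.inl e.data.1) = .universal) :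
    (.inl e.data.2.2, x * LoopGraph.eval _ e.data.2.1) ∈ Y := by
  have he := hY.universal _ _ hs ho (.inr e) e.data.2.1 (if_pos rfl)
  obtain ⟨r, y, hy, hr⟩ := hY.existential _ _ he rfl
  rcases r with r | f
  · have hy : (if e.data.2.2 = r then some [] else none) = some y := hy
    split_ifs at hy with h
    obtain rfl := Option.some.inj hy
    rw [h]
    simpa [LoopGraph.eval_nil] using hr
  · cases hy

/-- The existential player can keep up the invariant: she collects the group elements of the
guessed stack by short words, cancels them by inverse words of the same length when challenged, and
pops the index that is on top of the stack. -/
theorem GuessInv.existential (hΔ : Δ.IsGrp) (hY : G.Viable Y) (hσ : (G.init, σ.forget.val) ∈ Y)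
    (hshort : LetterGame.ShortStack G.param σ) {s : GuessState G G.param} {x}
    (h : GuessInv Y σ s x) (ho : (guess G).owner (.inl s) = .existential) :
    ∃ e : GuessEdge G G.param, e.data.1 = s ∧
      GuessInv Y σ e.data.2.2 (x * LoopGraph.eval _ e.data.2.1) := by
  cases h with
  | start =>
    obtain ⟨g, hg⟩ := exists_substack_nil σ.2 σ.1 .refl
    obtain ⟨x, rfl, hx⟩ := (hg.shortStack hshort).1
    refine ⟨.start, rfl, ?_⟩
    have : (1 * LoopGraph.eval _ [(.inl none, true)] :
        (pdGraph (Option (U × Fin G.param)) Δ).GraphMonoid) = guessVal (1, []) := by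
      rw [← val_nil]
      exact (val_of_act rfl).symm
    change GuessInv Y σ (.pick 0) (1 * LoopGraph.eval _ [(.inl none, true)])
    rw [this]
    exact .pick 0 (1, []) x (by rwa [one_mul]) hx
  | pick j τ x hτ hx =>
    cases j using Fin.lastCases with
    | cast j =>
      refine ⟨.pick j x.head?, rfl, ?_⟩
      change GuessInv Y σ (.pick j.succ) (τ.guessVal * LoopGraph.eval _ (groupWord x.head?))
      rw [guessVal_mul_groupWord]
      refine .pick _ _ x.tail ?_ ?_
      · rw [mul_assoc, ← LoopGraph.eval_append]
        rcases x with _ | ⟨a, x⟩ <;> exact hτ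
      · have := j.2
        simp only [Fin.val_castSucc] at hx
        simp only [List.length_tail, Fin.val_succ]
        omega
    | last =>
      obtain rfl : x = [] := List.length_eq_zero_iff.1 (by simp only [Fin.val_last] at hx; omega)
      rw [LoopGraph.eval_nil, mul_one] at hτ
      cases hτ with
      | refl =>
        refine ⟨.enter, rfl, ?_⟩
        change GuessInv Y τ (.game G.init) (τ.guessVal * LoopGraph.eval _ [])
        rw [LoopGraph.eval_nil, mul_one]
        exact .game _ τ hσ
      | @pop g _ p _ hτ =>
        refine ⟨.push p.1 p.2, rfl, ?_⟩
        change GuessInv Y σ .challenge (τ.guessVal * LoopGraph.eval _ [(.inl (some p), true)])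
        rw [guessVal_push]
        exact .challenge _ hτ
  | challenge => cases ho
  | read i b j τ x h1 hx hτ hi =>
    cases j using Fin.lastCases with
    | cast j =>
      refine ⟨.cancel i b j x.head?, rfl, ?_⟩
      change GuessInv Y σ (.read i b j.succ) (τ.guessVal * LoopGraph.eval _ (groupWord x.head?))
      rw [guessVal_mul_groupWord]
      refine .read _ _ _ _ x.tail ?_ ?_ hτ hi
      · rw [mul_assoc, ← LoopGraph.eval_append]
        rcases x with _ | ⟨a, x⟩ <;> exact h1
      · have := j.2
        simp only [Fin.val_castSucc] at hx
        simp only [List.length_tail, Fin.val_succ]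
        omega
    | last =>
      obtain rfl : x = [] := List.length_eq_zero_iff.1 (by simp only [Fin.val_last] at hx; omega)
      rw [LoopGraph.eval_nil, mul_one] at h1
      rcases τ with ⟨g, _ | ⟨⟨p, h⟩, l⟩⟩
      · obtain rfl : g = 1 := h1
        refine ⟨.bottom i b, rfl, .happy _ ?_⟩
        have : val ((1, []) : Stack (Option (U × Fin G.param)) Δ) =
            guessVal (1, []) * LoopGraph.eval _ [(.inl none, false)] :=
          val_of_act (act_pop_eq_some_iff.2 rfl)
        exact this ▸ val_mem_rInv hΔ _
      · obtain rfl : g = 1 := h1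
        refine ⟨.pop i b p.1 p.2, rfl, ?_⟩
        change GuessInv Y σ (enterGuard i ((guard i).step (some b) p.2))
          (guessVal (1, (p, h) :: l) * LoopGraph.eval _ [(.inl (some p), false)])
        rw [guessVal_pop]
        have hi' : (guard i).evalFrom ((guard i).step (some b) p.2) (indices l) ≠ none := hi
        obtain ⟨b', hb'⟩ : ∃ b', (guard i).step (some b) p.2 = some b' := by
          rw [← Option.ne_none_iff_exists']
          intro hnone
          rw [hnone, guard_evalFrom_none] at hi'
          exact hi' rfl
        rw [hb'] at hi' ⊢
        obtain ⟨⟨x, rfl, hx⟩, hl⟩ := List.forall_mem_cons.1 hτ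
        obtain ⟨y, hy, hxy⟩ := hΔ.exists_mul_eval_eq_one x
        exact .read i b' 0 _ y hxy (by simpa [hy] using hx) hl hi'
  | happy x hx =>
    refine ⟨.happy, rfl, .happy _ ?_⟩
    change x * LoopGraph.eval _ [] ∈ _
    rwa [LoopGraph.eval_nil, mul_one]
  | game q τ h =>
    obtain ⟨r, y, hy, hr⟩ := hY.existential _ _ h ho
    obtain ⟨e, he, rfl⟩ := exists_edge_of_trans_eq hy
    obtain ⟨rfl, rfl⟩ := Prod.ext_iff.1 he
    refine ⟨.call e, rfl, ?_⟩
    change GuessInv Y σ (.mid e 0) (τ.guessVal * LoopGraph.eval _ [])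
    rw [LoopGraph.eval_nil, mul_one]
    exact .mid e 0 τ hr
  | mid e k τ h =>
    cases k using Fin.lastCases with
    | cast k =>
      rw [Fin.val_castSucc, List.drop_eq_getElem_cons k.2, LoopGraph.eval_cons, ← mul_assoc] at h
      obtain ⟨τ', hτ'⟩ := exists_act_eq_some (LoopGraph.mem_rInv_of_mul (hY.rInv _ _ h))
      rw [← val_of_act hτ'] at h
      obtain ⟨i, τ'', hτ'', rfl⟩ := exists_act_copyLetter G.param_pos hτ'
      refine ⟨.act e k i, rfl, ?_⟩
      change GuessInv Y σ (.mid e k.succ)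
        (τ.guessVal * LoopGraph.eval _ [copyLetter i (e.word.get k)])
      rw [List.get_eq_getElem, guessVal_of_act hτ'']
      exact .mid e k.succ τ'' h
    | last =>
      refine ⟨.ret e, rfl, ?_⟩
      change GuessInv Y σ (.game e.1.2) (τ.guessVal * LoopGraph.eval _ [])
      rw [LoopGraph.eval_nil, mul_one]
      rw [Fin.val_last, List.drop_length, LoopGraph.eval_nil, mul_one] at h
      exact .game _ _ h

theorem GuessInv.universal (hY : G.Viable Y) (hshort : LetterGame.ShortStack G.param σ)
    (hi : indices σ.2 ∈ guardLanguage G.param) (e : GuessEdge G G.param) {x}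
    (h : GuessInv Y σ e.data.1 x) (ho : (guess G).owner (.inl e.data.1) = .universal) :
    GuessInv Y σ e.data.2.2 (x * LoopGraph.eval _ e.data.2.1) := by
  cases e with
  | resume =>
    obtain ⟨⟩ : GuessInv Y σ .challenge x := h
    rename_i τ hτ
    obtain ⟨x, hx, hlen⟩ := (hτ.shortStack hshort).1
    change GuessInv Y σ (.pick 0) (guessVal _ * LoopGraph.eval _ [])
    rw [LoopGraph.eval_nil, mul_one]
    refine .pick 0 _ x ?_ hlen
    rw [one_mul, hx]
    exact hτ
  | challenge i =>
    obtain ⟨⟩ : GuessInv Y σ .challenge x := h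
    rename_i τ hτ
    change GuessInv Y σ (.read i false 0) (guessVal _ * LoopGraph.eval _ [])
    rw [LoopGraph.eval_nil, mul_one]
    exact .read i false 0 _ [] (mul_one _) (Nat.zero_le _) (hτ.shortStack hshort).2
      (mem_guardLanguage.1 (hτ.indices_mem hi) i)
  | call e =>
    change GuessInv Y σ (.game e.1.1) x at h
    cases h with
    | game _ τ h =>
      change GuessInv Y σ (.mid e 0) (guessVal _ * LoopGraph.eval _ [])
      rw [LoopGraph.eval_nil, mul_one]
      exact .mid e 0 τ (hY.universal _ _ h ho _ _ e.trans_eq)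
  | _ => cases ho

theorem UV.guess_FV (hΔ : Δ.IsGrp) (h : G.UV) : (guess G).FV [] := by
  obtain ⟨Y, σ, hY, hσ, hlen, hshort⟩ := h.exists_small_stack hΔ
  obtain ⟨τ, rfl, hτ⟩ := exists_forget_eq hlen
  have hshort := shortStack_of_forget hshort
  exact (viable_guess (I := GuessInv Y τ) (fun _ _ h => h.rInv hΔ)
    (fun _ _ h ho => h.existential hΔ hY hσ hshort ho)
    (fun e _ h ho => h.universal hY hshort hτ e ho)).existsWins GuessInv.start

end Arena

end Guess

section Guess

variable {U : Type u} {W : Type v} {Δ : LoopGraph W} {Q : Type w}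

namespace Arena

/-! ### From a guess to an initial credit -/

open Stack

/-- The homomorphism that deletes the bottom symbol and the indices of the pushdown letters. -/
def forgetHom (U : Type u) (Δ : LoopGraph W) (n : ℕ) :
    (pdGraph (Option (U × Fin n)) Δ).GraphMonoid →* (pdGraph U Δ).GraphMonoid :=
  LoopGraph.evalHom _
    (fun
      | (.inl none, _) => 1
      | (.inl (some p), s) => (pdGraph U Δ).eval [(.inl p.1, s)]
      | (.inr c, s) => (pdGraph U Δ).eval [(.inr c, s)])
    (by
      rintro ((_ | p) | c)
      · exact one_mul 1
      · exact LoopGraph.eval_cancel _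
      · exact LoopGraph.eval_cancel _)
    (by
      rintro (a | a) (b | b) s t h
      · exact h.elim
      · exact h.elim
      · exact h.elim
      · exact LoopGraph.eval_comm (Γ := pdGraph U Δ) (a := .inr a) (b := .inr b) h s t)

theorem forgetHom_copyLetter {n : ℕ} (i : Fin n) (x : Letter (U ⊕ W)) :
    forgetHom U Δ n (LoopGraph.eval _ [copyLetter i x]) = (pdGraph U Δ).eval [x] := by
  rcases x with ⟨a | c, s⟩ <;> rfl

variable [Fintype Q] [DecidableEq Q] [DecidableEq U] [DecidableEq W] {G : Arena (pdGraph U Δ) Q}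

/-- The viable configurations of the copy of the given arena, without bottom symbol and indices. -/
theorem Viable.forget {Y : Set (guess G).Conf} (hY : (guess G).Viable Y) :
    G.Viable {c | ∃ x, (.inl (.game c.1), x) ∈ Y ∧ c.2 = forgetHom U Δ G.param x} := by
  -- The remaining letters of a transition are processed in the chain of the states `mid`.
  have mid : ∀ (e : G.Edge) (k : Fin (e.word.length + 1)) x, (.inl (.mid e k), x) ∈ Y →
      ∃ y, (.inl (.game e.1.2), y) ∈ Y ∧
        forgetHom U Δ G.param x * (pdGraph U Δ).eval (e.word.drop k) =
          forgetHom U Δ G.param y := by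
    intro e k
    induction k using Fin.reverseInduction with
    | last =>
      intro x hx
      obtain ⟨f, hf, hfY⟩ := hY.exists_guessEdge hx rfl
      cases f with
      | ret f =>
        obtain ⟨rfl, -⟩ := GuessState.mid.inj hf
        refine ⟨_, hfY, ?_⟩
        change _ = forgetHom U Δ G.param (x * 1)
        rw [mul_one, Fin.val_last, List.drop_length, LoopGraph.eval_nil, mul_one]
      | act f k i =>
        obtain ⟨rfl, h⟩ := GuessState.mid.inj hf
        exact absurd (eq_of_heq h) (Fin.castSucc_ne_last k)
      | _ => cases hf
    | cast k ih =>
      intro x hx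
      obtain ⟨f, hf, hfY⟩ := hY.exists_guessEdge hx rfl
      cases f with
      | ret f =>
        obtain ⟨rfl, h⟩ := GuessState.mid.inj hf
        exact absurd (eq_of_heq h).symm (Fin.castSucc_ne_last k)
      | act f k' i =>
        obtain ⟨rfl, h⟩ := GuessState.mid.inj hf
        obtain rfl := Fin.castSucc_injective _ (eq_of_heq h)
        obtain ⟨y, hy, hxy⟩ := ih _ hfY
        refine ⟨y, hy, ?_⟩
        change forgetHom U Δ G.param (x * LoopGraph.eval _ [copyLetter i (f.word.get k')]) * _ = _
          at hxy
        rw [map_mul, forgetHom_copyLetter, mul_assoc, ← LoopGraph.eval_cons] at hxy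
        rw [← hxy, Fin.val_castSucc, List.drop_eq_getElem_cons k'.2]
        rfl
      | _ => cases hf
  have call : ∀ (e : G.Edge) x,
      (.inl (.mid e 0), x * LoopGraph.eval _ (GuessEdge.call (n := G.param) e).data.2.1) ∈ Y →
      ∃ y, (.inl (.game e.1.2), y) ∈ Y ∧
        forgetHom U Δ G.param x * (pdGraph U Δ).eval e.word = forgetHom U Δ G.param y := by
    intro e x hx
    change (_, x * 1) ∈ Y at hx
    rw [mul_one] at hx
    exact mid e 0 x hx
  refine ⟨?_, ?_, ?_⟩
  · rintro q _ ⟨x, hx, rfl⟩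
    obtain ⟨y, hy⟩ := hY.rInv _ _ hx
    exact ⟨forgetHom U Δ G.param y, by rw [← map_mul, hy, map_one]⟩
  · rintro q _ ⟨x, hx, rfl⟩ ho
    obtain ⟨f, hf, hfY⟩ := hY.exists_guessEdge hx ho
    cases f with
    | call e =>
      obtain rfl := GuessState.game.inj hf
      exact ⟨_, _, e.trans_eq, call e x hfY⟩
    | _ => cases hf
  · rintro q _ ⟨x, hx, rfl⟩ ho r y hy
    obtain ⟨e, he, rfl⟩ := exists_edge_of_trans_eq hy
    obtain ⟨rfl, rfl⟩ := Prod.ext_iff.1 he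
    exact call e x (hY.guessEdge_mem (.call e) hx ho)

variable {Y : Set (guess G).Conf}

/-- In the state `sad`, the bottom symbol is popped again and again, until the stack is empty. -/
theorem Viable.sad_not_mem (hY : (guess G).Viable Y)
    (l : List (Option (U × Fin G.param) × Δ.GraphMonoid)) (g : Δ.GraphMonoid) :
    (.inl .sad, val (g, l)) ∉ Y := by
  induction l generalizing g with
  | nil =>
    intro h
    obtain ⟨f, hf, hfY⟩ := hY.exists_guessEdge h rfl
    cases f with
    | sad =>
      obtain ⟨τ, hτ⟩ := exists_act_eq_some (hY.rInv _ _ hfY)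
      simpa using congrArg Prod.snd (act_pop_eq_some_iff.1 hτ)
    | _ => cases hf
  | cons p l ih =>
    intro h
    obtain ⟨f, hf, hfY⟩ := hY.exists_guessEdge h rfl
    cases f with
    | sad =>
      obtain ⟨τ, hτ⟩ := exists_act_eq_some (hY.rInv _ _ hfY)
      have hl := (List.cons.inj (Prod.mk.inj (act_pop_eq_some_iff.1 hτ)).2).2
      change (.inl .sad, val (g, p :: l) * LoopGraph.eval _ [(.inl none, false)]) ∈ Y at hfY
      rw [← val_of_act hτ] at hfY
      exact ih τ.1 (by rw [hl]; exact hfY)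
    | _ => cases hf

/-- On the chains of states that read group letters, only the topmost group element changes. -/
theorem Viable.exists_chain_last (hY : (guess G).Viable Y)
    {s : Fin (G.param + 1) → GuessState G G.param}
    (ho : ∀ j, (guess G).owner (.inl (s j)) = .existential)
    (hs : ∀ j (e : GuessEdge G G.param), e.data.1 = s (Fin.castSucc j) →
      ∃ o, e.data.2 = (groupWord o, s j.succ))
    (j : Fin (G.param + 1)) (l : List ((U × Fin G.param) × Δ.GraphMonoid)) (g : Δ.GraphMonoid)
    (h : (.inl (s j), guessVal (g, l)) ∈ Y) :
    ∃ g, (.inl (s (Fin.last _)), guessVal (g, l)) ∈ Y := by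
  induction j using Fin.reverseInduction generalizing g with
  | last => exact ⟨g, h⟩
  | cast j ih =>
    obtain ⟨e, he, heY⟩ := hY.exists_guessEdge h (ho _)
    obtain ⟨o, heo⟩ := hs j e he
    rw [heo, guessVal_mul_groupWord] at heY
    exact ih _ heY

/-- A viable configuration at the beginning of a chain for `D_i` contains a stack that `D_i` does
not reject, since the letters can only be popped in the order in which they are stored, and the
bottom symbol only after them. -/
theorem Viable.evalFrom_ne_none (hY : (guess G).Viable Y) (i : Fin G.param)
    (l : List ((U × Fin G.param) × Δ.GraphMonoid)) (b : Bool) (g : Δ.GraphMonoid)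
    (h : (.inl (.read i b 0), guessVal (g, l)) ∈ Y) :
    (guard i).evalFrom (some b) (indices l) ≠ none := by
  induction l generalizing b g with
  | nil => exact Option.some_ne_none b
  | cons p l ih =>
    obtain ⟨g, h⟩ := hY.exists_chain_last (s := .read i b) (fun _ => rfl) (by
      intro j e he
      cases e with
      | cancel i' b' j' o =>
        obtain ⟨rfl, rfl, hj⟩ := GuessState.read.inj he
        obtain rfl := Fin.castSucc_injective _ hj
        exact ⟨o, rfl⟩
      | pop | bottom =>
        exact absurd (GuessState.read.inj he).2.2.symm (Fin.castSucc_ne_last j)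
      | _ => cases he) 0 _ g h
    obtain ⟨e, he, heY⟩ := hY.exists_guessEdge h rfl
    cases e with
    | cancel i' b' j o =>
      exact absurd (GuessState.read.inj he).2.2 (Fin.castSucc_ne_last j)
    | pop i' b' a j =>
      obtain ⟨rfl, rfl, -⟩ := GuessState.read.inj he
      obtain ⟨τ, hτ⟩ := exists_act_eq_some (hY.rInv _ _ heY)
      obtain ⟨h1, h2⟩ := Prod.mk.inj (act_pop_eq_some_iff.1 hτ)
      rcases p with ⟨p, k⟩
      obtain rfl : g = 1 := h1
      obtain rfl : p = (a, j) := Option.some.inj (Prod.mk.inj (List.cons.inj h2).1).1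
      change (.inl (enterGuard i' ((guard i').step (some b') j)),
        guessVal (1, ((a, j), k) :: l) * LoopGraph.eval _ [(.inl (some (a, j)), false)]) ∈ Y at heY
      rw [guessVal_pop] at heY
      change (guard i').evalFrom ((guard i').step (some b') j) (indices l) ≠ none
      rcases hstep : (guard i').step (some b') j with _ | b
      · rw [hstep] at heY
        exact absurd heY (hY.sad_not_mem _ _)
      · rw [hstep] at heY
        exact ih b _ heY
    | bottom i' b' =>
      obtain ⟨τ, hτ⟩ := exists_act_eq_some (hY.rInv _ _ heY)
      have := List.cons.inj (Prod.mk.inj (act_pop_eq_some_iff.1 hτ)).2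
      simpa using (Prod.mk.inj this.1).1
    | _ => cases he

/-- As long as the existential player does not enter the copy of the given arena, the stack grows.
The universal player can challenge her guess, so that the indices in the stack form a word that no
guard rejects; the length of such words is bounded. -/
theorem Viable.exists_game_mem (hY : (guess G).Viable Y)
    (l : List ((U × Fin G.param) × Δ.GraphMonoid)) (g : Δ.GraphMonoid)
    (h : (.inl (.pick 0), guessVal (g, l)) ∈ Y) : ∃ x, (.inl (.game G.init), x) ∈ Y := by
  induction hd : 2 ^ G.param - l.length using Nat.strong_induction_on generalizing l g with
  | _ d ih =>
    obtain ⟨g, h⟩ := hY.exists_chain_last (s := .pick) (fun _ => rfl) (by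
      intro j e he
      cases e with
      | pick j' o =>
        obtain rfl := Fin.castSucc_injective _ (GuessState.pick.inj he)
        exact ⟨o, rfl⟩
      | push | enter => exact absurd (GuessState.pick.inj he).symm (Fin.castSucc_ne_last j)
      | _ => cases he) 0 _ g h
    obtain ⟨e, he, heY⟩ := hY.exists_guessEdge h rfl
    cases e with
    | pick j o => exact absurd (GuessState.pick.inj he) (Fin.castSucc_ne_last j)
    | enter => exact ⟨_, heY⟩
    | push a i =>
      change (.inl .challenge, guessVal (g, l) * LoopGraph.eval _ [(.inl (some (a, i)), true)]) ∈ Y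
        at heY
      rw [guessVal_push] at heY
      have hmem : indices (((a, i), g) :: l) ∈ guardLanguage G.param := fun k => by
        have := hY.guessEdge_mem (.challenge k) heY rfl
        change (.inl (.read k false 0), guessVal _ * 1) ∈ Y at this
        rw [mul_one] at this
        exact hY.evalFrom_ne_none k _ _ _ this
      have hlen := length_lt_of_mem_guardLanguage hmem
      simp only [indices, List.length_map, List.length_cons] at hlen
      have := hY.guessEdge_mem .resume heY rfl
      change (.inl (.pick 0), guessVal _ * 1) ∈ Y at this
      rw [mul_one] at this
      exact ih _ (by simp only [List.length_cons]; omega) _ _ this rfl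
    | _ => cases he

theorem UV_of_guess_FV (h : (guess G).FV []) : G.UV := by
  obtain ⟨Y, hY, hstart⟩ := existsWins_iff_exists_viable.1 h
  obtain ⟨e, he, heY⟩ := hY.exists_guessEdge (s := .start) hstart rfl
  have hpick : (.inl (.pick 0), guessVal (1, [])) ∈ Y := by
    cases e with
    | start =>
      have : guessVal (1, []) = val (1, []) * LoopGraph.eval (pdGraph (Option (U × Fin G.param)) Δ)
          [(.inl none, true)] := val_of_act rfl
      rw [this, val_nil]
      exact heY
    | _ => cases he
  obtain ⟨x, hx⟩ := hY.exists_game_mem _ _ hpick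
  obtain ⟨y, hy⟩ := LoopGraph.exists_eval_eq (forgetHom U Δ G.param x)
  exact ⟨y, existsWins_iff_exists_viable.2 ⟨_, hY.forget, x, hx, hy⟩⟩

end Arena

end Guess

/-! ### The size of the arena with guessing -/

section Size

variable {U : Type u} {W : Type v} {Δ : LoopGraph W} {Q : Type w}

theorem card_pdGraph_adj (U : Type u) (Δ : LoopGraph W) :
    Nat.card {a : (U ⊕ W) × (U ⊕ W) // (pdGraph U Δ).Adj a.1 a.2} =
      Nat.card {a : W × W // Δ.Adj a.1 a.2} := by
  symm
  refine Nat.card_congr (Equiv.ofBijective (fun a => ⟨(.inr a.1.1, .inr a.1.2), a.2⟩) ⟨?_, ?_⟩)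
  · rintro ⟨⟨a, b⟩, h⟩ ⟨⟨c, d⟩, h'⟩ heq
    obtain ⟨h1, h2⟩ := Prod.mk.inj (Subtype.mk.inj heq)
    exact Subtype.ext (Prod.ext (Sum.inr.inj h1) (Sum.inr.inj h2))
  · rintro ⟨⟨a | a, b | b⟩, h⟩
    · exact h.elim
    · exact h.elim
    · exact h.elim
    · exact ⟨⟨(a, b), h⟩, rfl⟩

namespace Arena

theorem card_guessState_le [Fintype U] [Fintype W] [Fintype Q]
    (G : Arena (pdGraph U Δ) Q) (n : ℕ) :
    Fintype.card (GuessState G n) ≤ 1 + ((n + 1) + (1 + (n * (2 * (n + 1)) +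
      (1 + (1 + (Fintype.card Q + ∑ e : G.Edge, (e.word.length + 1))))))) := by
  have := Fintype.card_le_of_surjective (α := Unit ⊕ Fin (n + 1) ⊕ Unit ⊕
    (Fin n × Bool × Fin (n + 1)) ⊕ Unit ⊕ Unit ⊕ Q ⊕ Σ e : G.Edge, Fin (e.word.length + 1))
    (β := GuessState G n)
    (Sum.elim (fun _ => .start) <| Sum.elim .pick <| Sum.elim (fun _ => .challenge) <|
      Sum.elim (fun p => .read p.1 p.2.1 p.2.2) <| Sum.elim (fun _ => .happy) <|
      Sum.elim (fun _ => .sad) <| Sum.elim .game fun p => .mid p.1 p.2) (by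
    intro s
    cases s with
    | start => exact ⟨.inl (), rfl⟩
    | pick j => exact ⟨.inr (.inl j), rfl⟩
    | challenge => exact ⟨.inr (.inr (.inl ())), rfl⟩
    | read i b j => exact ⟨.inr (.inr (.inr (.inl (i, b, j)))), rfl⟩
    | happy => exact ⟨.inr (.inr (.inr (.inr (.inl ())))), rfl⟩
    | sad => exact ⟨.inr (.inr (.inr (.inr (.inr (.inl ()))))), rfl⟩
    | game q => exact ⟨.inr (.inr (.inr (.inr (.inr (.inr (.inl q)))))), rfl⟩
    | mid e k => exact ⟨.inr (.inr (.inr (.inr (.inr (.inr (.inr ⟨e, k⟩)))))), rfl⟩)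
  simpa only [Fintype.card_sum, Fintype.card_prod, Fintype.card_sigma, Fintype.card_fin,
    Fintype.card_bool, Fintype.card_unit] using this

theorem card_guessEdge_le [Fintype U] [Fintype W] [Fintype Q] (G : Arena (pdGraph U Δ) Q) (n : ℕ) :
    Fintype.card (GuessEdge G n) ≤ 1 + (n * (Fintype.card W * 2 + 1) + (Fintype.card U * n +
      (1 + (1 + (n + (n * (2 * (n * (Fintype.card W * 2 + 1))) + (n * (2 * (Fintype.card U * n)) +
      (n * 2 + (1 + (1 + (Fintype.card G.Edge + ((∑ e : G.Edge, e.word.length * n) +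
      Fintype.card G.Edge)))))))))))) := by
  have := Fintype.card_le_of_surjective (α := Unit ⊕ (Fin n × Option (Letter W)) ⊕ (U × Fin n) ⊕
    Unit ⊕ Unit ⊕ Fin n ⊕ (Fin n × Bool × Fin n × Option (Letter W)) ⊕
    (Fin n × Bool × U × Fin n) ⊕ (Fin n × Bool) ⊕ Unit ⊕ Unit ⊕ G.Edge ⊕
    (Σ e : G.Edge, Fin e.word.length × Fin n) ⊕ G.Edge)
    (β := GuessEdge G n)
    (Sum.elim (fun _ => .start) <| Sum.elim (fun p => .pick p.1 p.2) <|
      Sum.elim (fun p => .push p.1 p.2) <| Sum.elim (fun _ => .enter) <|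
      Sum.elim (fun _ => .resume) <| Sum.elim .challenge <|
      Sum.elim (fun p => .cancel p.1 p.2.1 p.2.2.1 p.2.2.2) <|
      Sum.elim (fun p => .pop p.1 p.2.1 p.2.2.1 p.2.2.2) <|
      Sum.elim (fun p => .bottom p.1 p.2) <| Sum.elim (fun _ => .happy) <|
      Sum.elim (fun _ => .sad) <| Sum.elim .call <|
      Sum.elim (fun p => .act p.1 p.2.1 p.2.2) .ret) (by
    intro s
    cases s with
    | start => exact ⟨.inl (), rfl⟩
    | pick j g => exact ⟨.inr (.inl (j, g)), rfl⟩
    | push a i => exact ⟨.inr (.inr (.inl (a, i))), rfl⟩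
    | enter => exact ⟨.inr (.inr (.inr (.inl ()))), rfl⟩
    | resume => exact ⟨.inr (.inr (.inr (.inr (.inl ())))), rfl⟩
    | challenge i => exact ⟨.inr (.inr (.inr (.inr (.inr (.inl i))))), rfl⟩
    | cancel i b j g => exact ⟨.inr (.inr (.inr (.inr (.inr (.inr (.inl (i, b, j, g))))))), rfl⟩
    | pop i b a j =>
      exact ⟨.inr (.inr (.inr (.inr (.inr (.inr (.inr (.inl (i, b, a, j)))))))), rfl⟩
    | bottom i b =>
      exact ⟨.inr (.inr (.inr (.inr (.inr (.inr (.inr (.inr (.inl (i, b))))))))), rfl⟩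
    | happy =>
      exact ⟨.inr (.inr (.inr (.inr (.inr (.inr (.inr (.inr (.inr (.inl ()))))))))), rfl⟩
    | sad =>
      exact ⟨.inr (.inr (.inr (.inr (.inr (.inr (.inr (.inr (.inr (.inr (.inl ())))))))))), rfl⟩
    | call e =>
      exact ⟨.inr (.inr (.inr (.inr (.inr (.inr (.inr (.inr (.inr (.inr (.inr
        (.inl e))))))))))), rfl⟩
    | act e k i =>
      exact ⟨.inr (.inr (.inr (.inr (.inr (.inr (.inr (.inr (.inr (.inr (.inr
        (.inr (.inl ⟨e, k, i⟩)))))))))))), rfl⟩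
    | ret e =>
      exact ⟨.inr (.inr (.inr (.inr (.inr (.inr (.inr (.inr (.inr (.inr (.inr
        (.inr (.inr e)))))))))))), rfl⟩)
  simpa only [Fintype.card_sum, Fintype.card_prod, Fintype.card_sigma, Fintype.card_fin,
    Fintype.card_bool, Fintype.card_unit, Fintype.card_option] using this

variable [Fintype Q] [DecidableEq Q] [DecidableEq U] [DecidableEq W]

theorem length_guess_word_le (G : Arena (pdGraph U Δ) Q) (e : (guess G).Edge) :
    e.word.length ≤ 1 := by
  have hdata : ∀ f : GuessEdge G G.param, f.data.2.1.length ≤ 1 := by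
    intro f
    cases f with
    | pick _ g => rcases g with _ | g <;> simp [GuessEdge.data, groupWord]
    | cancel _ _ _ g => rcases g with _ | g <;> simp [GuessEdge.data, groupWord]
    | _ => simp [GuessEdge.data]
  obtain ⟨x, hx, he⟩ : ∃ x, e.word = x ∧ (guess G).trans e.1.1 e.1.2 = some x :=
    ⟨_, rfl, e.trans_eq⟩
  rw [hx]
  clear hx
  obtain ⟨⟨s | f, t | g⟩, _⟩ := e
  · cases he
  · have he : (if g.data.1 = s then some g.data.2.1 else none) = some x := he
    split_ifs at he
    obtain rfl := Option.some.inj he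
    exact hdata g
  · have he : (if f.data.2.2 = t then some [] else none) = some x := he
    split_ifs at he
    obtain rfl := Option.some.inj he
    exact Nat.zero_le _
  · cases he

/-- Each transition is cut into two by the state that subdivides it. -/
theorem card_guess_edge_le [Fintype U] [Fintype W] (G : Arena (pdGraph U Δ) Q) :
    Fintype.card (guess G).Edge ≤ 2 * Fintype.card (GuessEdge G G.param) := by
  rw [two_mul, ← Fintype.card_sum]
  refine Fintype.card_le_of_injective (fun e => match e.1 with
    | (.inl _, .inr f) => .inl f
    | (.inr f, _) => .inr f
    | (.inl _, .inl _) => .inl .start) ?_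
  have h1 : ∀ {s g}, ((guess G).trans (.inl s) (.inr g)).isSome → g.data.1 = s := by
    intro s g h
    by_contra hne
    have : (if g.data.1 = s then some g.data.2.1 else none).isSome := h
    simp [hne] at this
  have h2 : ∀ {s g}, ((guess G).trans (.inr g) (.inl s)).isSome → g.data.2.2 = s := by
    intro s g h
    by_contra hne
    have : (if g.data.2.2 = s then some ([] : List (Letter (GuessVertex U W G.param)))
      else none).isSome := h
    simp [hne] at this
  rintro ⟨⟨s | f, t | g⟩, h⟩ ⟨⟨s' | f', t' | g'⟩, h'⟩ heq
  all_goals try cases h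
  all_goals try cases h'
  all_goals try cases heq
  · obtain rfl := (h1 h).symm.trans (h1 h')
    rfl
  · obtain rfl := (h2 h).symm.trans (h2 h')
    rfl

/-- A bound for the number of states of the arena with guessing, before its transitions are
subdivided. -/
noncomputable def stateBound : Polynomial ℕ :=
  1 + ((.X + 1) + (1 + (.X * (2 * (.X + 1)) + (1 + (1 + (.X + .X))))))

/-- A bound for the number of transitions of the arena with guessing, before they are
subdivided. -/
noncomputable def edgeBound : Polynomial ℕ :=
  1 + (.X * (.X * 2 + 1) + (.X * .X + (1 + (1 + (.X + (.X * (2 * (.X * (.X * 2 + 1))) +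
    (.X * (2 * (.X * .X)) + (.X * 2 + (1 + (1 + (.X + (.X * .X + .X))))))))))))

/-- A bound for the size of the arena with guessing. -/
noncomputable def sizeBound : Polynomial ℕ :=
  (.X * .X + 1 + .X) + .X + (stateBound + edgeBound) + 2 * edgeBound * 2

theorem size_guess_le [Fintype U] [Fintype W] (G : Arena (pdGraph U Δ) Q) :
    (guess G).size ≤ sizeBound.eval G.size := by
  have hsize : G.size = Fintype.card U + Fintype.card W + Nat.card {a : W × W // Δ.Adj a.1 a.2} +
      Fintype.card Q + ∑ e : G.Edge, (1 + e.word.length) := by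
    rw [size, card_pdGraph_adj, Fintype.card_sum]
  have hsum : ∑ e : G.Edge, (1 + e.word.length) =
      Fintype.card G.Edge + ∑ e : G.Edge, e.word.length := by
    rw [Finset.sum_add_distrib, Finset.sum_const, smul_eq_mul, mul_one, Finset.card_univ]
  have hsum' : ∑ e : G.Edge, (e.word.length + 1) = ∑ e : G.Edge, (1 + e.word.length) :=
    Finset.sum_congr rfl fun _ _ => add_comm _ _
  have hparam : G.param ≤ Fintype.card Q + ∑ e : G.Edge, e.word.length :=
    Nat.add_le_add_left (Finset.sum_le_sum fun _ _ => Nat.sub_le _ _) _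
  have hU : Fintype.card U ≤ G.size := by omega
  have hW : Fintype.card W ≤ G.size := by omega
  have hQ : Fintype.card Q ≤ G.size := by omega
  have hE : Fintype.card G.Edge ≤ G.size := by omega
  have hL : ∑ e : G.Edge, e.word.length ≤ G.size := by omega
  have hL' : ∑ e : G.Edge, (e.word.length + 1) ≤ G.size := by omega
  have hn : G.param ≤ G.size := by omega
  have hA : Nat.card {a : W × W // Δ.Adj a.1 a.2} ≤ G.size := by omega
  have hstate : Fintype.card (GuessState G G.param) ≤ stateBound.eval G.size := by
    refine (card_guessState_le G G.param).trans ?_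
    simp only [stateBound, Polynomial.eval_add, Polynomial.eval_mul, Polynomial.eval_X,
      Polynomial.eval_one, Polynomial.eval_ofNat]
    gcongr
  have hedge : Fintype.card (GuessEdge G G.param) ≤ edgeBound.eval G.size := by
    refine (card_guessEdge_le G G.param).trans ?_
    rw [← Finset.sum_mul]
    simp only [edgeBound, Polynomial.eval_add, Polynomial.eval_mul, Polynomial.eval_X,
      Polynomial.eval_one, Polynomial.eval_ofNat]
    gcongr
  have hwords : ∑ e : (guess G).Edge, (1 + e.word.length) ≤
      2 * Fintype.card (GuessEdge G G.param) * 2 := by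
    refine (Finset.sum_le_card_nsmul _ _ 2 fun e _ => ?_).trans
      (Nat.mul_le_mul_right 2 (card_guess_edge_le G))
    have := length_guess_word_le G e
    omega
  rw [size, card_pdGraph_adj, Fintype.card_sum, Fintype.card_sum, Fintype.card_option,
    Fintype.card_prod, Fintype.card_fin]
  simp only [sizeBound, Polynomial.eval_add, Polynomial.eval_mul, Polynomial.eval_X,
    Polynomial.eval_one, Polynomial.eval_ofNat]
  refine add_le_add (add_le_add (add_le_add ?_ hA) (add_le_add hstate hedge)) (hwords.trans ?_)
  · gcongr
  · gcongr

end Arena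

end Size

end Viability

theorem mainTheorem8 :
    (∀ m : ℕ,
      (∀ x y : List (Fin m), x ++ y ∈ guardLanguage m → y ∈ guardLanguage m) ∧
      ∃ z ∈ guardLanguage m, z.length = 2 ^ m - 1 ∧
        ∀ x ∈ guardLanguage m, x ≠ z → x.length < z.length) ∧
    ∃ P : Polynomial ℕ,
      ∀ (U : Type u) (W : Type v) (Q : Type w) [Fintype U] [DecidableEq U] [Fintype W]
        [DecidableEq W] [Fintype Q] [DecidableEq Q] (Δ : LoopGraph W) (_ : Δ.IsGrp)
        (G : Arena (pdGraph U Δ) Q),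
        (guess G).size ≤ P.eval G.size ∧ (G.UV ↔ (guess G).FV []) :=
  ⟨fun m => ⟨fun _ _ => mem_guardLanguage_of_append, exists_longest_mem_guardLanguage m⟩,
    Arena.sizeBound, fun _ _ _ _ _ _ _ _ _ _ hΔ G =>
      ⟨G.size_guess_le, Arena.UV.guess_FV hΔ, Arena.UV_of_guess_FV⟩⟩
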